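/- Let $k\ge 2$, $m\ge 1$ and $d\ge 1$ be integers, and let $X_1,\ldots,X_m\in\mathbb{C}^{d\times d}$ be positive semidefinite Hermitian matrices of rank at most $k$ such that $\sum_{i=1}^m X_i\preceq I_d$ (that is, $I_d-\sum_{i=1}^m X_i$ is positive semidefinite). Let $$\mu[X_1,\ldots,X_m](x):=\prod_{i=1}^m\Bigl(1-\frac{\partial}{\partial z_i}\Bigr)\det\Bigl[xI_d+\sum_{i=1}^m z_iX_i\Bigr]\Big|_{z_1=\cdots=z_m=0}$$ be their mixed characteristic polynomial, and let $\varepsilon:=\max_{1\le i\le m}\operatorname{tr}(X_i)$. If $\varepsilon\le\frac{(k-1)^2}{k}$, then $\mu[X_1,\ldots,X_m]$ has real coefficients and only real roots, and its largest root satisfies $$\operatorname{maxroot}\,\mu[X_1,\ldots,X_m]\le\left(\sqrt{1-\frac{\varepsilon}{k-1}}+\sqrt{\varepsilon}\right)^2 .$$ -/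

import Mathlib

open Polynomial
open scoped ComplexOrder

/-- The multivariate polynomial `det (x I + ∑ i, z_i X_i)` in the variables `z_i`, with
coefficients in `ℂ[x]`. -/
noncomputable def mixedDet {m d : ℕ} (A : Fin m → Matrix (Fin d) (Fin d) ℂ) :
    MvPolynomial (Fin m) ℂ[X] :=
  Matrix.det
    ((MvPolynomial.C (Polynomial.X : ℂ[X]) : MvPolynomial (Fin m) ℂ[X]) •
        (1 : Matrix (Fin d) (Fin d) (MvPolynomial (Fin m) ℂ[X]))
      + ∑ i, (MvPolynomial.X i : MvPolynomial (Fin m) ℂ[X]) •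
          (A i).map (fun a : ℂ => (MvPolynomial.C (Polynomial.C a) : MvPolynomial (Fin m) ℂ[X])))

/-- The differential operator `∏ i, (1 - ∂/∂z_i)`; the product is composition of (commuting)
operators, in the order of the indices. -/
noncomputable def oneSubPDerivProd (m : ℕ) : Module.End ℂ[X] (MvPolynomial (Fin m) ℂ[X]) :=
  (List.ofFn fun i : Fin m =>
    (1 - (MvPolynomial.pderiv i : Derivation ℂ[X] _ (MvPolynomial (Fin m) ℂ[X])).toLinearMap :
      Module.End ℂ[X] (MvPolynomial (Fin m) ℂ[X]))).prod

/-- The mixed characteristic polynomial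
`μ[A_1, …, A_m](x) = ∏ i, (1 - ∂/∂z_i) det (x I + ∑ i, z_i A_i)` at `z_1 = ⋯ = z_m = 0`. -/
noncomputable def mixedCharpoly {m d : ℕ} (A : Fin m → Matrix (Fin d) (Fin d) ℂ) : ℂ[X] :=
  MvPolynomial.eval (fun _ => (0 : ℂ[X])) (oneSubPDerivProd m (mixedDet A))

/-!
The proof is the barrier method of Marcus, Spielman and Srivastava, with a barrier estimate that uses
the bound `k` on the degree of the determinant in each variable.

For a fixed number `x`, the polynomial `P = det (x + ∑ z_i A_i)` (`detAt`) has degree at most `k` in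
every `z_i`, because `A_i` has rank at most `k` (`degreeOf_detAt_le_rank`). The operators `1 - ∂/∂z_i`
preserve nonvanishing on half-planes (`NonvanishingOn.sub_pderiv`). For nonreal `x` this shows that the
mixed characteristic polynomial does not vanish at `x`; being monic of degree `d`
(`monic_mixedCharpoly`, by counting total degrees), it has real coefficients.

For real `x > δ` the point `(-δ, …, -δ)` lies above the zeros of `P`, and the barriers
`Φ^i = ∂_i P / P` are there at most `ε / (x - δ)` (`barrier_detAt_le`). One applies the operators
`1 - ∂/∂z_i` in turn, raising the coordinate `z_i` by `δ` each time. If no barrier increases, the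
origin is finally above the zeros, so `x` is not a root.

The barrier step is a statement in one variable. As a function of `z_i`, stability gives
`Φ^j = c - a z_i + ∑ b_μ / (z_i - μ)` with `a, b_μ ≥ 0`, where the `μ` are among the at most `k` zeros
of `P` in the variable `z_i` (`exists_partial_fraction`, a rational case of the Nevanlinna
representation). It suffices to treat each pole `μ` separately (`shift_re_div_le`). The zero `μ` itself
contributes a term to `Φ^i` that cancels exactly, and concavity of `u ↦ u / (1 + δ u)` is needed only
for the other `k - 1` zeros (`shift_bound_of_mem`). A pole at infinity, that is `a ≠ 0`, also lowers
the number of finite zeros to `k - 1`. The resulting condition on `δ` is optimised in `exists_shift`.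

Passing from complex to real base points uses an elementary form of Hurwitz's theorem
(`NonvanishingOn.eval_ne_zero_of_boundary`).
-/

/-! ### Rational functions mapping the upper half-plane to the closed lower half-plane -/

/-- Multiplication by `C` cannot turn the `n`-th powers of the upper half-plane into the closed
lower half-plane unless `n = 1` and `C` is a negative real. -/
theorem eq_one_of_im_mul_pow_nonpos {C : ℂ} (hC : C ≠ 0) {n : ℕ} (hn : n ≠ 0)
    (h : ∀ w : ℂ, 0 < w.im → (C * w ^ n).im ≤ 0) : n = 1 ∧ C.im = 0 ∧ C.re ≤ 0 := by
  have h1 : n = 1 := by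
    by_contra hn1
    have hn2 : (2 : ℝ) ≤ n := by exact_mod_cast (show 2 ≤ n by omega)
    have hnpos : (0 : ℝ) < n := by linarith
    -- an angle `θ` whose `n`-fold multiple rotates `C` to the argument `τ`
    have key : ∀ τ : ℝ, C.arg < τ → τ < C.arg + n * Real.pi → Real.sin τ ≤ 0 := by
      intro τ h0 h2
      set θ : ℝ := (τ - C.arg) / n with hθ
      have hθ0 : 0 < θ := div_pos (by linarith) hnpos
      have hθ1 : θ < Real.pi := by rw [hθ, div_lt_iff₀ hnpos]; linarith
      have hnθ : C.arg + n * θ = τ := by rw [hθ]; field_simp; ring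
      have := h (Complex.exp (θ * Complex.I)) (by
        rw [Complex.exp_ofReal_mul_I_im]; exact Real.sin_pos_of_pos_of_lt_pi hθ0 hθ1)
      have e : C * Complex.exp (θ * Complex.I) ^ n
          = (‖C‖ : ℂ) * Complex.exp ((τ : ℝ) * Complex.I) := by
        rw [← Complex.exp_nat_mul]
        conv_lhs => rw [← Complex.norm_mul_exp_arg_mul_I C]
        rw [mul_assoc, ← Complex.exp_add, ← hnθ]
        congr 2
        push_cast
        ring
      rw [e, Complex.im_ofReal_mul, Complex.exp_ofReal_mul_I_im] at this
      exact nonpos_of_mul_nonpos_right this (norm_pos_iff.mpr hC)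
    have hpi := Real.pi_pos
    have a1 := Complex.neg_pi_lt_arg C
    have a2 := Complex.arg_le_pi C
    by_cases hα : C.arg < Real.pi / 2
    · have := key (Real.pi / 2) hα (by nlinarith)
      rw [Real.sin_pi_div_two] at this
      linarith
    · have := key (Real.pi / 4 + 2 * Real.pi) (by linarith) (by nlinarith)
      rw [Real.sin_add_two_pi] at this
      linarith [Real.sin_pos_of_pos_of_lt_pi (show 0 < Real.pi / 4 by linarith) (by linarith)]
  subst h1
  have h2 : ∀ M : ℝ, C.re + M * C.im ≤ 0 := by
    intro M
    have := h (M + Complex.I) (by simp)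
    simp [Complex.mul_im] at this
    linarith
  refine ⟨rfl, ?_, by simpa using h2 0⟩
  by_contra him
  have := h2 ((1 - C.re) / C.im)
  rw [div_mul_cancel₀ _ him] at this
  linarith

theorem im_limit_nonpos {f : ℝ → ℂ} {L : ℂ}
    (hf : Filter.Tendsto f (nhdsWithin 0 (Set.Ioi 0)) (nhds L))
    (h : ∀ᶠ r in nhdsWithin (0 : ℝ) (Set.Ioi 0), (f r).im ≤ 0) : L.im ≤ 0 :=
  le_of_tendsto ((Complex.continuous_im.tendsto L).comp hf) h

/-- A pole of `h / g` on the real axis is simple, with nonnegative residue, if `h / g` maps the upper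
half-plane to the closed lower half-plane. -/
theorem pole_simple_of_im_nonpos {g h : ℂ[X]} (hg : g ≠ 0)
    (hroot : ∀ z, g.IsRoot z → z.im = 0)
    (him : ∀ s : ℂ, 0 < s.im → (h.eval s / g.eval s).im ≤ 0) {μ : ℂ} (hμ : g.IsRoot μ)
    (hh : h.eval μ ≠ 0) :
    ∃ G : ℂ[X], g = (X - C μ) * G ∧ G.eval μ ≠ 0 ∧ (h.eval μ / G.eval μ).im = 0 ∧
      0 ≤ (h.eval μ / G.eval μ).re := by
  obtain ⟨G, hG, hnd⟩ := exists_eq_pow_rootMultiplicity_mul_and_not_dvd g hg μ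
  set n := rootMultiplicity μ g with hn
  have hn0 : n ≠ 0 := ((rootMultiplicity_pos hg).2 hμ).ne'
  have hGμ : G.eval μ ≠ 0 := fun h0 => hnd (dvd_iff_isRoot.2 h0)
  set c := h.eval μ / G.eval μ with hc
  have hc0 : c ≠ 0 := div_ne_zero hh hGμ
  have key : ∀ w : ℂ, 0 < w.im → ((-1) ^ n * c * w ^ n).im ≤ 0 := by
    intro w hw
    have hw0 : w ≠ 0 := by rintro rfl; simp at hw
    -- approach `μ` along the direction `-w⁻¹`, which lies in the upper half-plane as well
    set v := -w⁻¹ with hv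
    have hvim : 0 < v.im := by
      rw [hv, Complex.neg_im, Complex.inv_im]
      have := Complex.normSq_pos.2 hw0
      rw [neg_div, neg_neg]; positivity
    have hv0 : v ≠ 0 := by rintro h; rw [h] at hvim; simp at hvim
    have hcont : Filter.Tendsto (fun r : ℝ => h.eval (μ + r * v) / (v ^ n * G.eval (μ + r * v)))
        (nhdsWithin 0 (Set.Ioi 0)) (nhds (h.eval μ / (v ^ n * G.eval μ))) := by
      have : ContinuousAt (fun r : ℝ => h.eval (μ + r * v) / (v ^ n * G.eval (μ + r * v))) 0 := by
        apply ContinuousAt.div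
        · exact (h.continuous.comp (by fun_prop)).continuousAt
        · exact (continuous_const.mul (G.continuous.comp (by fun_prop))).continuousAt
        · simpa using ⟨fun h => absurd h hv0, hGμ⟩
      have := this.tendsto.mono_left (nhdsWithin_le_nhds (s := Set.Ioi 0))
      simpa using this
    have hle := im_limit_nonpos hcont (by
      filter_upwards [self_mem_nhdsWithin] with r hr
      have hr : 0 < r := hr
      have him' := him (μ + r * v) (by simp [hroot μ hμ]; positivity)
      have e : h.eval (μ + r * v) / g.eval (μ + r * v)
          = ((r⁻¹ ^ n : ℝ) : ℂ) * (h.eval (μ + r * v) / (v ^ n * G.eval (μ + r * v))) := by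
        rw [hG]
        simp only [eval_mul, eval_pow, eval_sub, eval_X, eval_C, add_sub_cancel_left]
        push_cast
        rw [mul_pow, inv_pow]
        simp only [div_eq_mul_inv, mul_inv]
        ring
      rw [e, Complex.im_ofReal_mul] at him'
      exact nonpos_of_mul_nonpos_right him' (by positivity))
    convert hle using 2
    rw [hc, hv, neg_pow w⁻¹, inv_pow]
    have h1 : ((-1 : ℂ) ^ n) * (-1) ^ n = 1 := by rw [← mul_pow]; simp
    have h2 : ((-1 : ℂ) ^ n)⁻¹ = (-1) ^ n := by rw [← inv_pow]; norm_num
    simp only [div_eq_mul_inv, mul_inv, inv_inv, h2]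
    ring
  obtain ⟨h1, h2, h3⟩ := eq_one_of_im_mul_pow_nonpos
    (mul_ne_zero (pow_ne_zero n (by norm_num)) hc0) hn0 key
  rw [h1] at h2 h3 hG
  refine ⟨G, by simpa using hG, hGμ, ?_, ?_⟩
  · simpa using h2
  · simpa using h3

/-- A rational function `q + o(1)` at infinity mapping the upper half-plane to the closed lower
half-plane has polynomial part `c - a X` with `a ≥ 0`. -/
theorem polynomial_part_of_im_nonpos (q : ℂ[X]) (f : ℂ → ℂ)
    (hf : ∀ w : ℂ, 0 < w.im →
      Filter.Tendsto (fun r : ℝ => f ((r : ℂ)⁻¹ * w)) (nhdsWithin 0 (Set.Ioi 0)) (nhds 0))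
    (him : ∀ s : ℂ, 0 < s.im → (q.eval s + f s).im ≤ 0) :
    ∃ (c : ℂ) (a : ℝ), 0 ≤ a ∧ q = C c - C (a : ℂ) * X := by
  by_cases hn : q.natDegree = 0
  · exact ⟨q.coeff 0, 0, le_rfl, by simpa using eq_C_of_natDegree_eq_zero hn⟩
  set n := q.natDegree with hnd
  have hq0 : q ≠ 0 := by rintro rfl; simp [hnd] at hn
  have key : ∀ w : ℂ, 0 < w.im → (q.leadingCoeff * w ^ n).im ≤ 0 := by
    intro w hw
    have hw0 : w ≠ 0 := by rintro rfl; simp at hw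
    have h1 : Filter.Tendsto (fun r : ℝ => q.reverse.eval ((r : ℂ) * w⁻¹) * w ^ n
        + (r : ℂ) ^ n * f ((r : ℂ)⁻¹ * w)) (nhdsWithin 0 (Set.Ioi 0))
        (nhds (q.leadingCoeff * w ^ n)) := by
      have c1 : Continuous (fun r : ℝ => q.reverse.eval ((r : ℂ) * w⁻¹) * w ^ n) :=
        (q.reverse.continuous.comp (by fun_prop)).mul continuous_const
      have c2 : Continuous (fun r : ℝ => (r : ℂ) ^ n) := by fun_prop
      have t1 := (c1.tendsto 0).mono_left (nhdsWithin_le_nhds (s := Set.Ioi 0))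
      have t2 := ((c2.tendsto 0).mono_left (nhdsWithin_le_nhds (s := Set.Ioi 0))).mul (hf w hw)
      have t3 := t1.add t2
      simpa [← coeff_zero_eq_eval_zero, coeff_zero_reverse] using t3
    refine im_limit_nonpos h1 ?_
    filter_upwards [self_mem_nhdsWithin] with r hr
    have hr : 0 < r := hr
    have hrc : (r : ℂ) ≠ 0 := by exact_mod_cast hr.ne'
    have him' := him ((r : ℂ)⁻¹ * w) (by
      rw [← Complex.ofReal_inv, Complex.im_ofReal_mul]; positivity)
    have e : q.reverse.eval ((r : ℂ) * w⁻¹) * w ^ n + (r : ℂ) ^ n * f ((r : ℂ)⁻¹ * w)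
        = ((r ^ n : ℝ) : ℂ) * (q.eval ((r : ℂ)⁻¹ * w) + f ((r : ℂ)⁻¹ * w)) := by
      let _ : Invertible ((r : ℂ)⁻¹ * w) := invertibleOfNonzero (mul_ne_zero (inv_ne_zero hrc) hw0)
      have := eval₂_reverse_mul_pow (RingHom.id ℂ) ((r : ℂ)⁻¹ * w) q
      simp only [eval₂_id, invOf_eq_inv, mul_inv, inv_inv] at this
      rw [← this, ← hnd, mul_pow, inv_pow]
      push_cast
      field_simp
    rw [e, Complex.im_ofReal_mul]
    exact mul_nonpos_of_nonneg_of_nonpos (by positivity) him'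
  obtain ⟨h1, h2, h3⟩ := eq_one_of_im_mul_pow_nonpos (leadingCoeff_ne_zero.2 hq0) hn key
  refine ⟨q.coeff 0, -q.leadingCoeff.re, by linarith, ?_⟩
  have hlc : ((-q.leadingCoeff.re : ℝ) : ℂ) = -q.coeff 1 := by
    have : q.coeff 1 = q.leadingCoeff := by rw [leadingCoeff, ← hnd, h1]
    rw [this]
    apply Complex.ext <;> simp [h2]
  rw [hlc]
  conv_lhs => rw [eq_X_add_C_of_natDegree_le_one (p := q) (by omega)]
  simp
  ring

/-- The coprime case of `exists_partial_fraction`: every root of `g` is then a pole, hence simple, and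
`h` minus the interpolant `∑ b_μ g / (s - μ)` is divisible by `g`. -/
theorem exists_partial_fraction_of_isCoprime {g h : ℂ[X]} (hg : g ≠ 0) (hgh : IsCoprime g h)
    (hroot : ∀ z, g.IsRoot z → z.im = 0)
    (him : ∀ s : ℂ, 0 < s.im → (h.eval s / g.eval s).im ≤ 0) :
    ∃ (c : ℂ) (a : ℝ) (S : Finset ℂ) (b : ℂ → ℝ) (G : ℂ → ℂ[X]), 0 ≤ a ∧
      (a ≠ 0 → g.natDegree < h.natDegree) ∧ (∀ μ ∈ S, 0 ≤ b μ ∧ g = (X - C μ) * G μ) ∧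
      h = (C c - C (a : ℂ) * X) * g + ∑ μ ∈ S, C (b μ : ℂ) * G μ := by
  have hgs : ∀ s : ℂ, 0 < s.im → g.eval s ≠ 0 := fun s hs h0 => hs.ne' (hroot s h0)
  have hpole : ∀ μ : ℂ, ∃ G : ℂ[X], g.IsRoot μ → (g = (X - C μ) * G ∧ G.eval μ ≠ 0 ∧
      (h.eval μ / G.eval μ).im = 0 ∧ 0 ≤ (h.eval μ / G.eval μ).re) := by
    intro μ
    by_cases hμ : g.IsRoot μ
    · have hh : h.eval μ ≠ 0 := by
        intro h0
        obtain ⟨u, v, huv⟩ := hgh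
        have := congrArg (eval μ) huv
        simp [h0, hμ.eq_zero] at this
      obtain ⟨G, hG⟩ := pole_simple_of_im_nonpos hg hroot him hμ hh
      exact ⟨G, fun _ => hG⟩
    · exact ⟨0, fun h => absurd h hμ⟩
  choose G hG using hpole
  set S := g.roots.toFinset with hS
  have memS : ∀ μ, μ ∈ S ↔ g.IsRoot μ := fun μ => by simp [hS, hg]
  set b : ℂ → ℝ := fun μ => (h.eval μ / (G μ).eval μ).re with hb
  have hbval : ∀ μ ∈ S, (b μ : ℂ) * (G μ).eval μ = h.eval μ := by
    intro μ hμ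
    obtain ⟨-, h2, h3, -⟩ := hG μ ((memS μ).1 hμ)
    have : (b μ : ℂ) = h.eval μ / (G μ).eval μ := by
      apply Complex.ext <;> simp [hb, h3]
    rw [this, div_mul_cancel₀ _ h2]
  set T := ∑ μ ∈ S, C (b μ : ℂ) * G μ with hT
  have hTeval : ∀ ν ∈ S, T.eval ν = h.eval ν := by
    intro ν hν
    rw [hT, eval_finsetSum, Finset.sum_eq_single_of_mem ν hν]
    · rw [eval_mul, eval_C, hbval ν hν]
    · intro μ hμ hne
      have h1 := (hG μ ((memS μ).1 hμ)).1
      have h2 : g.eval ν = 0 := (memS ν).1 hν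
      rw [h1, eval_mul] at h2
      have h3 : (G μ).eval ν = 0 := by
        refine (mul_eq_zero.1 h2).resolve_left ?_
        simpa [sub_eq_zero] using hne.symm
      rw [eval_mul, h3, mul_zero]
  have hdvd : g ∣ h - T := by
    by_cases hE : h - T = 0
    · rw [hE]; exact dvd_zero _
    refine (IsAlgClosed.splits g).dvd_of_roots_le_roots hg ?_
    have hnd : g.roots.Nodup := by
      rw [Multiset.nodup_iff_count_le_one]
      intro μ
      by_cases hμ : g.IsRoot μ
      · obtain ⟨h1, h2, -⟩ := hG μ hμ
        rw [count_roots]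
        by_contra hlt
        have := (le_rootMultiplicity_iff hg).1 (show 2 ≤ rootMultiplicity μ g by omega)
        rw [pow_two] at this
        rw [h1] at this
        have := (mul_dvd_mul_iff_left (X_sub_C_ne_zero μ)).1 this
        exact h2 (dvd_iff_isRoot.1 this)
      · rw [Multiset.count_eq_zero_of_notMem (fun h => hμ (isRoot_of_mem_roots h))]
        exact zero_le_one
    rw [Multiset.le_iff_subset hnd]
    intro ν hν
    rw [mem_roots hE, IsRoot, eval_sub, hTeval ν (by simpa [hS] using hν), sub_self]
  obtain ⟨q, hq⟩ := hdvd
  have hh : h = q * g + T := by rw [mul_comm, ← hq]; ring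
  have hfrac : ∀ s : ℂ, 0 < s.im →
      h.eval s / g.eval s = q.eval s + ∑ μ ∈ S, (b μ : ℂ) / (s - μ) := by
    intro s hs
    have hgs' := hgs s hs
    rw [hh, eval_add, eval_mul, add_div, mul_div_cancel_right₀ _ hgs', hT, eval_finsetSum,
      Finset.sum_div]
    congr 1
    refine Finset.sum_congr rfl fun μ hμ => ?_
    have h1 := (hG μ ((memS μ).1 hμ)).1
    have h2 : g.eval s = (s - μ) * (G μ).eval s := by
      conv_lhs => rw [h1]
      simp
    rw [h2] at hgs' ⊢
    rw [eval_mul, eval_C]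
    exact mul_div_mul_right _ _ (right_ne_zero_of_mul hgs')
  obtain ⟨c, a, ha, hqa⟩ := polynomial_part_of_im_nonpos q
    (fun s => ∑ μ ∈ S, (b μ : ℂ) / (s - μ)) (by
      intro w hw
      have hw0 : w ≠ 0 := by rintro rfl; simp at hw
      rw [show (0 : ℂ) = ∑ μ ∈ S, 0 by simp]
      refine tendsto_finsetSum S fun μ _ => ?_
      have c1 : ContinuousAt (fun r : ℝ => (r : ℂ) * b μ / (w - r * μ)) 0 := by
        apply ContinuousAt.div
        · fun_prop
        · fun_prop
        · simpa using hw0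
      have t1 := c1.tendsto.mono_left (nhdsWithin_le_nhds (s := Set.Ioi 0))
      simp only [Complex.ofReal_zero, zero_mul, zero_div] at t1
      refine t1.congr' ?_
      filter_upwards [self_mem_nhdsWithin] with r hr
      have hrc : (r : ℂ) ≠ 0 := by exact_mod_cast (show (0 : ℝ) < r from hr).ne'
      rw [show (r : ℂ)⁻¹ * w - μ = (w - r * μ) / r by field_simp, div_div_eq_mul_div, mul_comm])
    (fun s hs => by rw [← hfrac s hs]; exact him s hs)
  refine ⟨c, a, S, b, G, ha, fun ha0 => ?_, fun μ hμ => ⟨(hG μ ((memS μ).1 hμ)).2.2.2,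
    (hG μ ((memS μ).1 hμ)).1⟩, by rw [← hqa, ← hT, ← hh]⟩
  by_contra hlt
  have hac : (a : ℂ) ≠ 0 := by exact_mod_cast ha0
  have hqd : q.natDegree = 1 := by
    rw [hqa, show C c - C (a : ℂ) * X = C (-a : ℂ) * X + C c by simp; ring]
    exact natDegree_linear (neg_ne_zero.2 hac)
  have hq0 : q ≠ 0 := by rintro rfl; simp at hqd
  have hTd : T.natDegree ≤ g.natDegree := by
    refine natDegree_sum_le_of_forall_le _ _ fun μ hμ => ?_
    have h1 := (hG μ ((memS μ).1 hμ)).1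
    have hG0 : G μ ≠ 0 := by rintro h0; rw [h0, mul_zero] at h1; exact hg h1
    have : g.natDegree = 1 + (G μ).natDegree := by
      conv_lhs => rw [h1]
      rw [natDegree_mul (X_sub_C_ne_zero μ) hG0, natDegree_X_sub_C]
    exact (natDegree_C_mul_le _ _).trans (by omega)
  have h1 : (q * g).natDegree ≤ g.natDegree := by
    rw [show q * g = h - T by rw [hh]; ring]
    exact (natDegree_sub_le _ _).trans (max_le (by omega) hTd)
  rw [natDegree_mul hq0 hg, hqd] at h1
  omega

/-- Partial fractions of a rational function `h / g` with real poles mapping the upper half-plane to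
the closed lower half-plane: `h / g = c - a s + ∑ b_μ / (s - μ)` with `a, b_μ ≥ 0`. Written without
denominators, `G μ` being the cofactor `g / (s - μ)`. -/
theorem exists_partial_fraction {g h : ℂ[X]} (hg : g ≠ 0)
    (hroot : ∀ z, g.IsRoot z → z.im = 0)
    (him : ∀ s : ℂ, 0 < s.im → (h.eval s / g.eval s).im ≤ 0) :
    ∃ (c : ℂ) (a : ℝ) (S : Finset ℂ) (b : ℂ → ℝ) (G : ℂ → ℂ[X]), 0 ≤ a ∧
      (a ≠ 0 → g.natDegree < h.natDegree) ∧ (∀ μ ∈ S, 0 ≤ b μ ∧ g = (X - C μ) * G μ) ∧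
      h = (C c - C (a : ℂ) * X) * g + ∑ μ ∈ S, C (b μ : ℂ) * G μ := by
  by_cases hh : h = 0
  · exact ⟨0, 0, ∅, 0, 0, le_rfl, by simp, by simp, by simp [hh]⟩
  obtain ⟨d, g', h', hcop, rfl, rfl⟩ :
      ∃ d g' h' : ℂ[X], IsCoprime g' h' ∧ g = d * g' ∧ h = d * h' := by
    obtain ⟨g', hg'⟩ := EuclideanDomain.gcd_dvd_left g h
    obtain ⟨h', hh'⟩ := EuclideanDomain.gcd_dvd_right g h
    have hd : EuclideanDomain.gcd g h ≠ 0 := fun h0 => hg (EuclideanDomain.gcd_eq_zero_iff.1 h0).1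
    have hab := EuclideanDomain.gcd_eq_gcd_ab g h
    refine ⟨EuclideanDomain.gcd g h, g', h', ⟨EuclideanDomain.gcdA g h, EuclideanDomain.gcdB g h,
      mul_left_cancel₀ hd ?_⟩, hg', hh'⟩
    rw [mul_add, mul_left_comm, ← hg', mul_left_comm, ← hh', mul_one]
    linear_combination -hab
  have hd : d ≠ 0 := left_ne_zero_of_mul hg
  have hg' : g' ≠ 0 := right_ne_zero_of_mul hg
  have hh' : h' ≠ 0 := right_ne_zero_of_mul hh
  obtain ⟨c, a, S, b, G, h1, h2, h3, h4⟩ := exists_partial_fraction_of_isCoprime hg' hcop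
    (fun z hz => hroot z (by simp [IsRoot, hz.eq_zero])) (by
      intro s hs
      have hds : d.eval s ≠ 0 := by
        intro h0
        exact hs.ne' (hroot s (by simp [IsRoot, h0]))
      have := him s hs
      rwa [eval_mul, eval_mul, mul_div_mul_left _ _ hds] at this)
  refine ⟨c, a, S, b, fun μ => d * G μ, h1, fun ha => ?_, fun μ hμ => ⟨(h3 μ hμ).1, ?_⟩, ?_⟩
  · rw [natDegree_mul hd hg', natDegree_mul hd hh']
    have := h2 ha
    omega
  · rw [mul_left_comm, ← (h3 μ hμ).2]
  · conv_lhs => rw [h4]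
    rw [mul_add, Finset.mul_sum]
    congr 1
    · ring
    · exact Finset.sum_congr rfl fun μ _ => by ring

/-! ### The one-variable barrier estimates -/

/-- Concavity of `u ↦ u / (1 + δ u)`, summed over at most `n` points `u = 1 / y` of total at most
`n u₀`. -/
theorem sum_one_div_add_le {Y : Multiset ℝ} {n : ℕ} {u₀ δ : ℝ} (hY : ∀ y ∈ Y, 0 < y)
    (hcard : Y.card ≤ n) (hu : 0 ≤ u₀) (hδ : 0 < δ)
    (hsum : (Y.map fun y => 1 / y).sum ≤ n * u₀) :
    (Y.map fun y => 1 / (δ + y)).sum ≤ n * u₀ / (1 + δ * u₀) := by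
  have hpos : 0 < 1 + δ * u₀ := by positivity
  have h1 : (Y.map fun y => 1 / (δ + y)).sum
      ≤ (Y.map fun y => (1 / y + δ * u₀ ^ 2) * ((1 + δ * u₀) ^ 2)⁻¹).sum := by
    refine Multiset.sum_map_le_sum_map _ _ fun y hy => ?_
    have hy := hY y hy
    -- the right-hand side is the tangent at `u₀`
    rw [← div_eq_mul_inv, div_le_div_iff₀ (by positivity) (by positivity),
      show (1 / y + δ * u₀ ^ 2) * (δ + y)
        = 1 * (1 + δ * u₀) ^ 2 + δ / y * (1 - u₀ * y) ^ 2 by field_simp; ring]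
    have : 0 ≤ δ / y * (1 - u₀ * y) ^ 2 := by positivity
    linarith
  refine h1.trans ?_
  rw [Multiset.sum_map_mul_right, Multiset.sum_map_add, Multiset.map_const', Multiset.sum_replicate,
    nsmul_eq_mul, ← div_eq_mul_inv, div_le_div_iff₀ (by positivity) hpos]
  have h2 : (Y.card : ℝ) ≤ n := by exact_mod_cast hcard
  have h3 : (Y.card : ℝ) * (δ * u₀ ^ 2) ≤ n * (δ * u₀ ^ 2) := by gcongr
  nlinarith

/-- The logarithmic derivative of a polynomial with negative real roots, on the nonnegative real
axis, as a sum over the absolute values of its roots. -/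
theorem derivative_div_eq_sum_neg_roots {g : ℂ[X]} (hroot : ∀ z, g.IsRoot z → z.im = 0)
    (hpos : ∀ s : ℝ, 0 ≤ s → g.eval (s : ℂ) ≠ 0) {s : ℝ} (hs : 0 ≤ s) :
    g.derivative.eval (s : ℂ) / g.eval (s : ℂ)
      = (((g.roots.map fun z => -z.re).map fun y => 1 / (s + y)).sum : ℝ) := by
  rw [(IsAlgClosed.splits g).eval_derivative_div_eval_of_ne_zero (hpos s hs), Multiset.map_map]
  rw [← Complex.ofRealHom_eq_coe (Multiset.sum _), map_multiset_sum, Multiset.map_map]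
  refine congrArg _ (Multiset.map_congr rfl fun z hz => ?_)
  have hz' : (z : ℂ) = (z.re : ℝ) := by
    apply Complex.ext <;> simp [hroot z (isRoot_of_mem_roots hz)]
  conv_lhs => rw [hz']
  simp [sub_eq_add_neg]

theorem neg_re_pos_of_isRoot {g : ℂ[X]} (hroot : ∀ z, g.IsRoot z → z.im = 0)
    (hpos : ∀ s : ℝ, 0 ≤ s → g.eval (s : ℂ) ≠ 0) {z : ℂ} (hz : g.IsRoot z) :
    0 < -z.re ∧ z = -((-z.re : ℝ) : ℂ) := by
  have hz' : z = -((-z.re : ℝ) : ℂ) := by apply Complex.ext <;> simp [hroot z hz]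
  refine ⟨?_, hz'⟩
  by_contra hlt
  refine hpos z.re (by linarith) ?_
  rw [show ((z.re : ℝ) : ℂ) = z by rw [hz']; simp]
  exact hz

/-- On the nonnegative axis, a Pick-type rational function with negative poles is decreasing. -/
theorem re_div_eval_one_le {g h : ℂ[X]} (hroot : ∀ z, g.IsRoot z → z.im = 0)
    (him : ∀ s : ℂ, 0 < s.im → (h.eval s / g.eval s).im ≤ 0)
    (hpos : ∀ s : ℝ, 0 ≤ s → g.eval (s : ℂ) ≠ 0) :
    (h.eval 1 / g.eval 1).re ≤ (h.eval 0 / g.eval 0).re := by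
  have hg : g ≠ 0 := by rintro rfl; exact hpos 0 le_rfl (by simp)
  obtain ⟨c, a, S, b, G, ha, -, hG, hh⟩ := exists_partial_fraction hg hroot him
  have key : ∀ s : ℝ, 0 ≤ s → h.eval (s : ℂ) / g.eval (s : ℂ)
      = c + ((-(a * s) + ∑ μ ∈ S, b μ / (s + -μ.re) : ℝ) : ℂ) := by
    intro s hs
    have hgs := hpos s hs
    have e1 : ∀ μ ∈ S, b μ * (G μ).eval (s : ℂ) / g.eval (s : ℂ)
        = ((b μ / (s + -μ.re) : ℝ) : ℂ) := by
      intro μ hμ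
      have hμr : g.IsRoot μ := by rw [(hG μ hμ).2]; simp
      obtain ⟨hy, hμe⟩ := neg_re_pos_of_isRoot hroot hpos hμr
      have h2 : g.eval (s : ℂ) = ((s + -μ.re : ℝ) : ℂ) * (G μ).eval (s : ℂ) := by
        conv_lhs => rw [(hG μ hμ).2]
        push_cast at hμe ⊢
        rw [eval_mul, eval_sub, eval_X, eval_C]
        linear_combination -(G μ).eval (s : ℂ) * hμe
      rw [h2] at hgs ⊢
      rw [mul_div_mul_right _ _ (right_ne_zero_of_mul hgs), Complex.ofReal_div]
    conv_lhs => rw [hh]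
    simp only [eval_add, eval_mul, eval_sub, eval_C, eval_X, eval_finsetSum]
    rw [add_div, mul_div_cancel_right₀ _ hgs, Finset.sum_div, Finset.sum_congr rfl e1]
    push_cast
    ring
  have k1 := key 1 zero_le_one
  have k0 := key 0 le_rfl
  simp only [Complex.ofReal_one, Complex.ofReal_zero] at k1 k0
  rw [k1, k0, Complex.add_re, Complex.add_re, Complex.ofReal_re, Complex.ofReal_re]
  have : ∑ μ ∈ S, b μ / (1 + -μ.re) ≤ ∑ μ ∈ S, b μ / (0 + -μ.re) := by
    refine Finset.sum_le_sum fun μ hμ => ?_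
    have hμr : g.IsRoot μ := by rw [(hG μ hμ).2]; simp
    have hy := (neg_re_pos_of_isRoot hroot hpos hμr).1
    exact div_le_div_of_nonneg_left (hG μ hμ).1 (by linarith) (by linarith)
  linarith

/-- The bound on the logarithmic derivative `φ` of `g` at `δ` that pays for a shift by `δ`, at a root
`-y` of `g`. Only the at most `n` other roots enter the concavity estimate. -/
theorem shift_bound_of_mem {Y : Multiset ℝ} {n : ℕ} {u₀ δ : ℝ} (hY : ∀ y ∈ Y, 0 < y)
    (hcard : Y.card ≤ n + 1) (hu : 0 ≤ u₀) (hδ : 0 < δ)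
    (hsum : (Y.map fun y => 1 / y).sum ≤ n * u₀)
    (hcond : n * u₀ / (1 + δ * u₀) ≤ 1 - 1 / δ) {y : ℝ} (hy : y ∈ Y) :
    y ≤ δ * (δ + y) * (1 - (Y.map fun y => 1 / (δ + y)).sum) := by
  obtain ⟨Z, rfl⟩ := Multiset.exists_cons_of_mem hy
  have hy0 := hY y hy
  simp only [Multiset.map_cons, Multiset.sum_cons, Multiset.card_cons] at hsum hcard ⊢
  have h1 : 0 < 1 / y := by positivity
  have hZ := sum_one_div_add_le (Y := Z) (n := n) (fun z hz => hY z (Multiset.mem_cons_of_mem hz))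
    (by omega) hu hδ (by linarith)
  have h2 : (Z.map fun y => 1 / (δ + y)).sum ≤ 1 - 1 / δ := hZ.trans hcond
  have h3 : δ * (δ + y) * (1 - (1 / (δ + y) + (Z.map fun y => 1 / (δ + y)).sum))
      = δ * (δ + y) * (1 - (Z.map fun y => 1 / (δ + y)).sum) - δ := by field_simp; ring
  rw [h3]
  have h4 : δ * (δ + y) * (1 / δ) ≤ δ * (δ + y) * (1 - (Z.map fun y => 1 / (δ + y)).sum) := by
    gcongr; linarith
  have h5 : δ * (δ + y) * (1 / δ) = δ + y := by field_simp
  linarith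

section Shift

variable {g h : ℂ[X]} {n : ℕ} {u₀ δ : ℝ}

/-- The logarithmic derivative of `g` is below `1` at `δ`, so `g - g'` does not vanish there. -/
theorem derivative_div_re_lt_one (hroot : ∀ z, g.IsRoot z → z.im = 0)
    (hpos : ∀ s : ℝ, 0 ≤ s → g.eval (s : ℂ) ≠ 0) (hgd : g.natDegree ≤ n + 1)
    (hu : 0 ≤ u₀) (hδ : 0 < δ) (hcond : n * u₀ / (1 + δ * u₀) ≤ 1 - 1 / δ)
    (hbar : (g.derivative.eval 0 / g.eval 0).re ≤ n * u₀) :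
    (g.derivative.eval (δ : ℂ) / g.eval (δ : ℂ)).re < 1 := by
  have h0 := derivative_div_eq_sum_neg_roots hroot hpos (s := 0) le_rfl
  rw [derivative_div_eq_sum_neg_roots hroot hpos hδ.le, Complex.ofReal_re]
  rw [Complex.ofReal_zero] at h0
  rw [h0, Complex.ofReal_re] at hbar
  simp only [zero_add] at hbar
  set Y := g.roots.map fun z => -z.re with hYdef
  have hY : ∀ y ∈ Y, 0 < y := by
    intro y hy
    obtain ⟨z, hz, rfl⟩ := Multiset.mem_map.1 hy
    exact (neg_re_pos_of_isRoot hroot hpos (isRoot_of_mem_roots hz)).1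
  have hcard : Y.card ≤ n + 1 := by
    rw [hYdef, Multiset.card_map]; exact (card_roots' g).trans hgd
  rcases Multiset.empty_or_exists_mem Y with h | ⟨y, hy⟩
  · simp [h]
  · have h1 := shift_bound_of_mem hY hcard hu hδ hbar hcond hy
    have hy0 := hY y hy
    have h2 : 0 < δ * (δ + y) := by positivity
    have := (pos_iff_pos_of_mul_pos (hy0.trans_le h1)).1 h2
    linarith

/-- Replacing `g, h` by `g - g', h - h'` and moving from `0` to `δ` does not increase `h / g`. -/
theorem shift_re_div_le (hroot : ∀ z, g.IsRoot z → z.im = 0)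
    (him : ∀ s : ℂ, 0 < s.im → (h.eval s / g.eval s).im ≤ 0)
    (hpos : ∀ s : ℝ, 0 ≤ s → g.eval (s : ℂ) ≠ 0) (hgd : g.natDegree ≤ n + 1)
    (hhd : h.natDegree ≤ n + 1)
    (hu : 0 ≤ u₀) (hδ : 0 < δ) (hcond : n * u₀ / (1 + δ * u₀) ≤ 1 - 1 / δ)
    (hbar : (g.derivative.eval 0 / g.eval 0).re ≤ n * u₀) :
    ((h - h.derivative).eval (δ : ℂ) / (g - g.derivative).eval (δ : ℂ)).re
      ≤ (h.eval 0 / g.eval 0).re := by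
  have hlt := derivative_div_re_lt_one hroot hpos hgd hu hδ hcond hbar
  have hg : g ≠ 0 := by rintro rfl; exact hpos 0 le_rfl (by simp)
  have h0 := derivative_div_eq_sum_neg_roots hroot hpos (s := 0) le_rfl
  have hd := derivative_div_eq_sum_neg_roots hroot hpos hδ.le
  rw [Complex.ofReal_zero] at h0
  rw [hd, Complex.ofReal_re] at hlt
  rw [h0, Complex.ofReal_re] at hbar
  simp only [zero_add] at hbar
  set Y := g.roots.map fun z => -z.re with hYdef
  have hY : ∀ y ∈ Y, 0 < y := by
    intro y hy
    obtain ⟨z, hz, rfl⟩ := Multiset.mem_map.1 hy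
    exact (neg_re_pos_of_isRoot hroot hpos (isRoot_of_mem_roots hz)).1
  have hcard : Y.card ≤ g.natDegree := by
    rw [hYdef, Multiset.card_map]; exact card_roots' g
  have hbound := fun y (hy : y ∈ Y) =>
    shift_bound_of_mem hY (hcard.trans hgd) hu hδ hbar hcond hy
  have hless : Y.card ≤ n → (Y.map fun y => 1 / (δ + y)).sum ≤ 1 - 1 / δ := fun hc =>
    (sum_one_div_add_le hY hc hu hδ hbar).trans hcond
  set φ := (Y.map fun y => 1 / (δ + y)).sum with hφ
  have hφ1 : 0 < 1 - φ := by linarith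
  obtain ⟨c, a, S, b, G, ha, hadeg, hG, hh⟩ := exists_partial_fraction hg hroot him
  have hgδ := hpos δ hδ.le
  have hg0 : g.eval 0 ≠ 0 := by simpa using hpos 0 le_rfl
  have hg' : g.derivative.eval (δ : ℂ) = φ * g.eval (δ : ℂ) := by
    rw [← hd, div_mul_cancel₀ _ hgδ]
  have hmem : ∀ μ ∈ S, -μ.re ∈ Y ∧ 0 < -μ.re ∧ μ = -((-μ.re : ℝ) : ℂ) := by
    intro μ hμ
    have hμr : g.IsRoot μ := by rw [(hG μ hμ).2]; simp
    exact ⟨Multiset.mem_map_of_mem _ ((mem_roots hg).2 hμr), neg_re_pos_of_isRoot hroot hpos hμr⟩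
  have hφc : (1 - φ : ℂ) ≠ 0 := by exact_mod_cast hφ1.ne'
  -- values of the cofactors `g / (s - μ)` and their derivatives
  have hG0 : ∀ μ ∈ S, b μ * (G μ).eval 0 / g.eval 0 = ((b μ / -μ.re : ℝ) : ℂ) := by
    intro μ hμ
    obtain ⟨-, hy, hμe⟩ := hmem μ hμ
    have h2 : g.eval 0 = ((-μ.re : ℝ) : ℂ) * (G μ).eval 0 := by
      conv_lhs => rw [(hG μ hμ).2]
      rw [eval_mul, eval_sub, eval_X, eval_C]
      linear_combination -(G μ).eval 0 * hμe
    rw [h2] at hg0 ⊢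
    rw [mul_div_mul_right _ _ (right_ne_zero_of_mul hg0), Complex.ofReal_div]
  have hGδ : ∀ μ ∈ S, b μ * ((G μ).eval (δ : ℂ) - (G μ).derivative.eval (δ : ℂ))
      / ((1 - φ) * g.eval (δ : ℂ))
      = ((b μ * (1 / (δ + -μ.re) + 1 / ((δ + -μ.re) ^ 2 * (1 - φ))) : ℝ) : ℂ) := by
    intro μ hμ
    obtain ⟨-, hy, hμe⟩ := hmem μ hμ
    set y := -μ.re with hydef
    have hyδ : ((δ + y : ℝ) : ℂ) ≠ 0 := by exact_mod_cast (by positivity : (0 : ℝ) < δ + y).ne'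
    have h2 : g.eval (δ : ℂ) = ((δ + y : ℝ) : ℂ) * (G μ).eval (δ : ℂ) := by
      conv_lhs => rw [(hG μ hμ).2]
      rw [eval_mul, eval_sub, eval_X, eval_C]
      push_cast
      linear_combination -(G μ).eval (δ : ℂ) * hμe
    have h3 : g.derivative.eval (δ : ℂ)
        = (G μ).eval (δ : ℂ) + ((δ + y : ℝ) : ℂ) * (G μ).derivative.eval (δ : ℂ) := by
      conv_lhs => rw [(hG μ hμ).2]
      simp only [derivative_mul, derivative_sub, derivative_X, derivative_C, eval_add, eval_mul,
        eval_sub, eval_X, eval_C, sub_zero, one_mul]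
      push_cast
      linear_combination -(G μ).derivative.eval (δ : ℂ) * hμe
    rw [hg', h2] at h3
    have hGne : (G μ).eval (δ : ℂ) ≠ 0 := by
      rw [h2] at hgδ; exact right_ne_zero_of_mul hgδ
    have h4 : (G μ).derivative.eval (δ : ℂ)
        = (φ - 1 / ((δ + y : ℝ) : ℂ)) * (G μ).eval (δ : ℂ) := by
      field_simp
      linear_combination -h3
    rw [h4, h2]
    rw [Complex.ofReal_add] at hyδ
    push_cast
    field_simp
    ring
  have e0 : h.eval 0 / g.eval 0 = c + ((∑ μ ∈ S, b μ / -μ.re : ℝ) : ℂ) := by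
    conv_lhs => rw [hh]
    simp only [eval_add, eval_mul, eval_sub, eval_C, eval_X, eval_finsetSum]
    rw [add_div, mul_div_cancel_right₀ _ hg0, Finset.sum_div, Finset.sum_congr rfl hG0]
    push_cast
    ring
  have eδ : (h - h.derivative).eval (δ : ℂ) / (g - g.derivative).eval (δ : ℂ)
      = c + ((-(a * (δ - 1 / (1 - φ))) +
        ∑ μ ∈ S, b μ * (1 / (δ + -μ.re) + 1 / ((δ + -μ.re) ^ 2 * (1 - φ))) : ℝ) : ℂ) := by
    have h1 : (g - g.derivative).eval (δ : ℂ) = (1 - φ) * g.eval (δ : ℂ) := by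
      rw [eval_sub, hg']; ring
    have h2 : (h - h.derivative).eval (δ : ℂ) = (c - a * (δ - 1 / (1 - φ))) *
        ((1 - φ) * g.eval (δ : ℂ))
        + ∑ μ ∈ S, b μ * ((G μ).eval (δ : ℂ) - (G μ).derivative.eval (δ : ℂ)) := by
      conv_lhs => rw [hh]
      simp only [eval_add, eval_mul, eval_sub, eval_C, eval_X, eval_finsetSum, derivative_add,
        derivative_mul, derivative_sub, derivative_C, derivative_X, derivative_sum, zero_mul,
        zero_add, mul_one, zero_sub, eval_neg, hg', mul_sub, Finset.sum_sub_distrib]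
      field_simp
      ring
    rw [h1, h2, add_div, mul_div_cancel_right₀ _ (mul_ne_zero hφc hgδ), Finset.sum_div,
      Finset.sum_congr rfl hGδ]
    push_cast
    ring
  rw [e0, eδ, Complex.add_re, Complex.add_re, Complex.ofReal_re, Complex.ofReal_re]
  have t1 : 0 ≤ a * (δ - 1 / (1 - φ)) := by
    by_cases ha0 : a = 0
    · simp [ha0]
    -- a pole at infinity leaves at most `n` finite roots
    · have := hless (by have := hadeg ha0; omega)
      have h2 : 1 / δ ≤ 1 - φ := by linarith
      refine mul_nonneg ha (sub_nonneg.2 ?_)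
      rw [div_le_iff₀ hφ1]
      rw [div_le_iff₀ hδ] at h2
      linarith
  have t2 : ∑ μ ∈ S, b μ * (1 / (δ + -μ.re) + 1 / ((δ + -μ.re) ^ 2 * (1 - φ)))
      ≤ ∑ μ ∈ S, b μ / -μ.re := by
    refine Finset.sum_le_sum fun μ hμ => ?_
    obtain ⟨hyY, hy, -⟩ := hmem μ hμ
    set y := -μ.re with hydef
    have hb := hbound y hyY
    rw [div_eq_mul_one_div (b μ) y]
    refine mul_le_mul_of_nonneg_left ?_ (hG μ hμ).1
    have hδy : 0 < δ + y := by positivity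
    rw [← sub_nonneg]
    have : 1 / y - (1 / (δ + y) + 1 / ((δ + y) ^ 2 * (1 - φ)))
        = (δ * (δ + y) * (1 - φ) - y) / (y * ((δ + y) ^ 2 * (1 - φ))) := by
      field_simp
      ring
    rw [this]
    exact div_nonneg (by linarith) (by positivity)
  linarith

end Shift

/-! ### Restrictions of multivariate polynomials to lines -/

section Multivariate

variable {ι : Type*}

/-- The restriction `t ↦ P (a + t v)` of `P` to the complex line through `a` in the real
direction `v`. -/
noncomputable def slice (P : MvPolynomial ι ℂ) (a : ι → ℂ) (v : ι → ℝ) : ℂ[X] :=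
  MvPolynomial.aeval (fun j => C (a j) + C (v j : ℂ) * X) P

theorem eval_slice (P : MvPolynomial ι ℂ) (a : ι → ℂ) (v : ι → ℝ) (s : ℂ) :
    (slice P a v).eval s = MvPolynomial.eval (fun j => a j + v j * s) P := by
  unfold slice
  induction P using MvPolynomial.induction_on with
  | C c => simp
  | add p q hp hq => simp [hp, hq]
  | mul_X p j hp => simp [hp]

theorem eval_slice_zero (P : MvPolynomial ι ℂ) (a : ι → ℂ) (v : ι → ℝ) :
    (slice P a v).eval 0 = MvPolynomial.eval a P := by
  simp [eval_slice]

theorem slice_sub (P Q : MvPolynomial ι ℂ) (a : ι → ℂ) (v : ι → ℝ) :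
    slice (P - Q) a v = slice P a v - slice Q a v := map_sub _ _ _

theorem natDegree_slice_le (P : MvPolynomial ι ℂ) (a : ι → ℂ) (v : ι → ℝ) :
    (slice P a v).natDegree ≤ P.totalDegree := by
  have := MvPolynomial.aeval_natDegree_le (n := 1) P le_rfl
    (fun j => C (a j) + C (v j : ℂ) * X) (fun j => by compute_degree)
  simpa [slice] using this

theorem degreeOf_pderiv_le {R : Type*} [CommSemiring R] (P : MvPolynomial ι R) (i j : ι) :
    MvPolynomial.degreeOf j (MvPolynomial.pderiv i P) ≤ MvPolynomial.degreeOf j P := by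
  rw [MvPolynomial.degreeOf_le_iff]
  intro α hα
  rw [MvPolynomial.mem_support_iff, MvPolynomial.coeff_pderiv] at hα
  have := MvPolynomial.monomial_le_degreeOf j
    (MvPolynomial.mem_support_iff.2 (left_ne_zero_of_mul hα))
  exact le_trans (by simp) this

theorem pderiv_pderiv_comm {R : Type*} [CommRing R] (P : MvPolynomial ι R) (i j : ι) :
    MvPolynomial.pderiv i (MvPolynomial.pderiv j P)
      = MvPolynomial.pderiv j (MvPolynomial.pderiv i P) := by
  classical
  have : ⁅(MvPolynomial.pderiv i : Derivation R (MvPolynomial ι R) (MvPolynomial ι R)),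
      (MvPolynomial.pderiv j : Derivation R (MvPolynomial ι R) (MvPolynomial ι R))⁆ = 0 := by
    refine MvPolynomial.derivation_ext fun k => ?_
    rw [Derivation.commutator_apply, MvPolynomial.pderiv_X, MvPolynomial.pderiv_X,
      Pi.single_apply, Pi.single_apply]
    split_ifs <;> simp
  have := congrArg (fun D => D P) this
  simpa [Derivation.commutator_apply, sub_eq_zero] using this

/-! ### Half-plane stability -/

/-- `P` has no zero with all coordinates in the half-plane `σ * Im z > c` (used with `σ = ±1`). -/
def NonvanishingOn (σ c : ℝ) (P : MvPolynomial ι ℂ) : Prop :=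
  ∀ z : ι → ℂ, (∀ i, c < σ * (z i).im) → MvPolynomial.eval z P ≠ 0

theorem inv_im_mul_neg {σ : ℝ} {w : ℂ} (h : 0 < σ * w.im) : σ * (1 / w).im < 0 := by
  have hw : w ≠ 0 := by rintro rfl; simp at h
  have := Complex.normSq_pos.2 hw
  rw [one_div, Complex.inv_im, neg_div, mul_neg, ← mul_div_assoc]
  have : 0 < σ * w.im / Complex.normSq w := by positivity
  linarith

/-- A polynomial whose roots keep a distance `ρ` from `t₀` cannot be small at `t₀` without being small
everywhere. This replaces the continuity of roots in the Hurwitz-type statement below. -/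
theorem norm_eval_le_of_root_dist {r : ℂ[X]} {t₀ : ℂ} (t : ℂ) {ρ : ℝ} (hρ : 0 < ρ)
    (h : ∀ τ, r.IsRoot τ → ρ ≤ ‖t₀ - τ‖) {N : ℕ} (hN : r.natDegree ≤ N) :
    ‖r.eval t‖ ≤ ‖r.eval t₀‖ * (1 + ‖t - t₀‖ / ρ) ^ N := by
  set K := 1 + ‖t - t₀‖ / ρ with hK
  have hK1 : 1 ≤ K := by rw [hK]; have : 0 ≤ ‖t - t₀‖ / ρ := by positivity
                         linarith
  have hprod : ∀ M : Multiset ℂ, (∀ τ ∈ M, ρ ≤ ‖t₀ - τ‖) →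
      ‖(M.map fun τ => t - τ).prod‖ ≤ ‖(M.map fun τ => t₀ - τ).prod‖ * K ^ M.card := by
    intro M hM
    induction M using Multiset.induction_on with
    | empty => simp
    | cons τ M ih =>
      have h1 := hM τ (Multiset.mem_cons_self _ _)
      have h2 := ih fun τ hτ => hM τ (Multiset.mem_cons_of_mem hτ)
      have h3 : ‖t - τ‖ ≤ ‖t₀ - τ‖ * K := by
        have e : ‖t - τ‖ ≤ ‖t - t₀‖ + ‖t₀ - τ‖ := norm_sub_le_norm_sub_add_norm_sub _ _ _
        have : ‖t - t₀‖ ≤ ‖t₀ - τ‖ * (‖t - t₀‖ / ρ) := by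
          rw [mul_div_assoc', le_div_iff₀ hρ, mul_comm]
          gcongr
        rw [hK]; linarith
      simp only [Multiset.map_cons, Multiset.prod_cons, norm_mul, Multiset.card_cons]
      calc _ ≤ (‖t₀ - τ‖ * K) * (‖(M.map fun τ => t₀ - τ).prod‖ * K ^ M.card) := by gcongr
        _ = _ := by ring
  have e := (IsAlgClosed.splits r).eval_eq_prod_roots
  rw [e t, e t₀, norm_mul, norm_mul, mul_assoc]
  refine mul_le_mul_of_nonneg_left ?_ (norm_nonneg _)
  refine (hprod _ fun τ hτ => h τ (isRoot_of_mem_roots hτ)).trans ?_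
  gcongr
  exact (card_roots' r).trans hN

/-- A form of Hurwitz's theorem: nonvanishing on an open half-plane passes to lines in a nonnegative
direction through boundary points, provided the polynomial is not identically zero on the line. -/
theorem NonvanishingOn.eval_ne_zero_of_boundary {σ : ℝ} (hσ : |σ| = 1) {P : MvPolynomial ι ℂ}
    (hP : NonvanishingOn σ 0 P) {z : ι → ℂ} (hz : ∀ j, 0 ≤ σ * (z j).im) {v : ι → ℝ}
    (hv : ∀ j, 0 ≤ v j) {t₀ t₁ : ℂ} (ht₀ : 0 < σ * t₀.im)
    (ht₁ : MvPolynomial.eval (fun j => z j + v j * t₁) P ≠ 0) :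
    MvPolynomial.eval (fun j => z j + v j * t₀) P ≠ 0 := by
  intro h0
  have hσ2 : σ * σ = 1 := by rw [← abs_mul_abs_self, hσ, one_mul]
  -- push the base point into the open half-plane by `η`
  let w : ℝ → ι → ℂ := fun η j => z j + (η * σ : ℝ) * Complex.I
  have hcont : ∀ t : ℂ, Filter.Tendsto
      (fun η : ℝ => ‖MvPolynomial.eval (fun j => w η j + v j * t) P‖)
      (nhdsWithin 0 (Set.Ioi 0)) (nhds ‖MvPolynomial.eval (fun j => z j + v j * t) P‖) := by
    intro t
    have c : Continuous (fun η : ℝ => ‖MvPolynomial.eval (fun j => w η j + v j * t) P‖) := by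
      refine continuous_norm.comp ((MvPolynomial.continuous_eval P).comp ?_)
      fun_prop
    have := (c.tendsto 0).mono_left (nhdsWithin_le_nhds (s := Set.Ioi 0))
    simpa [w] using this
  have hle := le_of_tendsto_of_tendsto (hcont t₁)
    ((hcont t₀).mul_const ((1 + ‖t₁ - t₀‖ / (σ * t₀.im)) ^ P.totalDegree)) (by
      filter_upwards [self_mem_nhdsWithin] with η hη
      have hη : 0 < η := hη
      rw [← eval_slice, ← eval_slice]
      refine norm_eval_le_of_root_dist t₁ ht₀ (fun τ hτ => ?_) (natDegree_slice_le _ _ _)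
      have hτim : σ * τ.im ≤ 0 := by
        by_contra hlt
        refine hP _ (fun j => ?_) ((eval_slice P (w η) v τ).symm.trans hτ)
        have h1 := hz j
        have h2 := mul_nonneg (hv j) (not_le.1 hlt).le
        simp only [w, Complex.add_im, Complex.im_ofReal_mul, Complex.I_im, mul_one]
        nlinarith
      calc σ * t₀.im ≤ σ * (t₀ - τ).im := by rw [Complex.sub_im]; linarith
        _ ≤ |σ * (t₀ - τ).im| := le_abs_self _
        _ = |(t₀ - τ).im| := by rw [abs_mul, hσ, one_mul]
        _ ≤ ‖t₀ - τ‖ := Complex.abs_im_le_norm _)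
  rw [h0, norm_zero, zero_mul] at hle
  exact ht₁ (norm_le_zero_iff.1 hle)

/-- Stability for both the upper and the lower half-plane. Up to a constant factor such polynomials
are the real stable ones. -/
structure IsBistable (P : MvPolynomial ι ℂ) : Prop where
  upper : NonvanishingOn 1 0 P
  lower : NonvanishingOn (-1) 0 P

/-- The real point `a` lies above the zeros of `P`. -/
def AboveRoots (P : MvPolynomial ι ℂ) (a : ι → ℝ) : Prop :=
  ∀ u : ι → ℝ, (∀ i, a i ≤ u i) → MvPolynomial.eval (fun i => (u i : ℂ)) P ≠ 0

theorem AboveRoots.slice_eval_ne_zero {P : MvPolynomial ι ℂ} {a u : ι → ℝ}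
    (ha : AboveRoots P a) (hu : ∀ j, 0 ≤ u j)
    {s : ℝ} (hs : 0 ≤ s) : (slice P (fun j => (a j : ℂ)) u).eval (s : ℂ) ≠ 0 := by
  rw [eval_slice]
  have := ha (fun j => a j + u j * s) (fun j => by have := mul_nonneg (hu j) hs; linarith)
  simpa using this

theorem IsBistable.slice_root_im {P : MvPolynomial ι ℂ} {a u : ι → ℝ} (hP : IsBistable P)
    (ha : AboveRoots P a) (hu : ∀ j, 0 ≤ u j) {z : ℂ}
    (hz : (slice P (fun j => (a j : ℂ)) u).IsRoot z) : z.im = 0 := by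
  have h0 : MvPolynomial.eval (fun j => (a j : ℂ) + u j * 0) P ≠ 0 := by
    simpa using ha a fun _ => le_rfl
  rw [IsRoot, eval_slice] at hz
  rcases lt_trichotomy z.im 0 with h | h | h
  · exact absurd hz (hP.lower.eval_ne_zero_of_boundary (by simp) (by simp) hu (by linarith) h0)
  · exact h
  · exact absurd hz (hP.upper.eval_ne_zero_of_boundary (by simp) (by simp) hu (by linarith) h0)

/-! ### Partial derivatives along coordinate lines -/

variable [DecidableEq ι]

theorem derivative_slice_single (P : MvPolynomial ι ℂ) (a : ι → ℂ) (i : ι) :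
    derivative (slice P a (Pi.single i 1)) = slice (MvPolynomial.pderiv i P) a (Pi.single i 1) := by
  unfold slice
  induction P using MvPolynomial.induction_on with
  | C c => simp
  | add p q hp hq => simp [hp, hq]
  | mul_X p j hp =>
    by_cases hij : j = i
    · subst hij
      simp [hp, Derivation.leibniz]
      ring
    · rw [map_mul, derivative_mul, hp, Derivation.leibniz, map_add, smul_eq_mul, smul_eq_mul,
        map_mul, map_mul, MvPolynomial.pderiv_X_of_ne hij]
      simp [Pi.single_apply, hij]
      ring

theorem natDegree_slice_single_le (P : MvPolynomial ι ℂ) (a : ι → ℂ) (i : ι) :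
    (slice P a (Pi.single i 1)).natDegree ≤ MvPolynomial.degreeOf i P := by
  unfold slice
  conv_lhs => rw [P.as_sum, map_sum]
  refine natDegree_sum_le_of_forall_le _ _ fun α hα => ?_
  rw [MvPolynomial.aeval_monomial]
  refine (natDegree_C_mul_le _ _).trans ?_
  have h1 : ∀ j, (C (a j) + C ((Pi.single i (1 : ℝ) : ι → ℝ) j : ℂ) * X).natDegree
      ≤ if j = i then 1 else 0 := by
    intro j
    split_ifs with h
    · compute_degree
    · simp [h]
  refine (natDegree_prod_le _ _).trans ?_
  refine le_trans (Finset.sum_le_sum (g := fun j => if j = i then α i else 0) fun j _ => ?_) ?_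
  · refine natDegree_pow_le.trans ?_
    have := Nat.mul_le_mul_left (α j) (h1 j)
    split_ifs at this ⊢ with h
    · subst h; simp
    · simpa using this
  · rw [Finset.sum_ite_eq']
    split_ifs
    · exact MvPolynomial.monomial_le_degreeOf i hα
    · exact Nat.zero_le _

/-- The operator `1 - ∂/∂z_i` preserves nonvanishing on a half-plane: on a line in direction `i` the
logarithmic derivative is a sum of reciprocals `1 / (z - τ)`, all in the same open half-plane. -/
theorem NonvanishingOn.sub_pderiv {σ c : ℝ} {P : MvPolynomial ι ℂ} (hP : NonvanishingOn σ c P)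
    (i : ι) : NonvanishingOn σ c (P - MvPolynomial.pderiv i P) := by
  intro z hz h0
  have hPz := hP z hz
  set r := slice P z (Pi.single i 1) with hr
  have hr0 : r.eval 0 = MvPolynomial.eval z P := eval_slice_zero _ _ _
  have hr0' : r.derivative.eval 0 = MvPolynomial.eval z (MvPolynomial.pderiv i P) := by
    rw [hr, derivative_slice_single, eval_slice_zero]
  have hsum := (IsAlgClosed.splits r).eval_derivative_div_eval_of_ne_zero (x := 0)
    (by rwa [hr0])
  rw [map_sub, sub_eq_zero] at h0
  rw [hr0', hr0, ← h0, div_self hPz] at hsum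
  have hroots : ∀ τ ∈ r.roots, σ * (1 / (0 - τ)).im < 0 := by
    intro τ hτ
    refine inv_im_mul_neg ?_
    by_contra hlt
    simp only [zero_sub, Complex.neg_im, not_lt] at hlt
    refine hP (fun j => z j + ((Pi.single i (1 : ℝ) : ι → ℝ) j : ℂ) * τ) (fun j => ?_) ?_
    · by_cases hj : j = i
      · subst hj
        have := hz j
        simp only [Pi.single_eq_same, Complex.ofReal_one, one_mul, Complex.add_im]
        linarith
      · simpa [Pi.single_apply, hj] using hz j
    · rw [← eval_slice]
      exact isRoot_of_mem_roots hτ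
  have him := congrArg (fun w : ℂ => σ * w.im) hsum
  simp only [Complex.one_im, mul_zero] at him
  rcases Multiset.empty_or_exists_mem r.roots with h | ⟨τ, hτ⟩
  · rw [h] at hsum
    simp at hsum
  · obtain ⟨M, hM⟩ := Multiset.exists_cons_of_mem hτ
    rw [hM] at him hroots
    have hle : ∀ M : Multiset ℂ, (∀ τ ∈ M, σ * (1 / (0 - τ)).im < 0) →
        σ * (M.map fun τ => 1 / (0 - τ)).sum.im ≤ 0 := by
      intro M hM
      induction M using Multiset.induction_on with
      | empty => simp
      | cons τ M ih =>
        rw [Multiset.map_cons, Multiset.sum_cons, Complex.add_im, mul_add]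
        have h1 := hM τ (Multiset.mem_cons_self _ _)
        have h2 := ih fun τ hτ => hM τ (Multiset.mem_cons_of_mem hτ)
        linarith
    rw [Multiset.map_cons, Multiset.sum_cons, Complex.add_im, mul_add] at him
    have h1 := hroots τ (Multiset.mem_cons_self _ _)
    have h2 := hle M fun τ hτ => hroots τ (Multiset.mem_cons_of_mem hτ)
    linarith

/-- The barrier function: the logarithmic derivative of `P` in direction `i` at the real
point `a`. -/
noncomputable def barrier (P : MvPolynomial ι ℂ) (i : ι) (a : ι → ℝ) : ℝ :=
  (MvPolynomial.eval (fun j => (a j : ℂ)) (MvPolynomial.pderiv i P)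
    / MvPolynomial.eval (fun j => (a j : ℂ)) P).re

section Slices

variable {P : MvPolynomial ι ℂ} {a u : ι → ℝ}

theorem IsBistable.slice_div_im_nonpos (hP : IsBistable P) (ha : AboveRoots P a)
    (hu : ∀ j, 0 ≤ u j) (i : ι) {s : ℂ} (hs : 0 < s.im) :
    ((slice (MvPolynomial.pderiv i P) (fun j => (a j : ℂ)) u).eval s
      / (slice P (fun j => (a j : ℂ)) u).eval s).im ≤ 0 := by
  have hg : (slice P (fun j => (a j : ℂ)) u).eval s ≠ 0 :=
    fun h => hs.ne' (hP.slice_root_im ha hu h)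
  rw [eval_slice] at hg
  rw [eval_slice, eval_slice]
  set w : ι → ℂ := fun j => (a j : ℂ) + u j * s with hw
  have hwim : ∀ j, 0 ≤ (w j).im := fun j => by
    simp only [hw, Complex.add_im, Complex.ofReal_im, Complex.im_ofReal_mul, zero_add]
    exact mul_nonneg (hu j) hs.le
  set r := slice P w (Pi.single i 1) with hr
  have hr0 : r.eval 0 = MvPolynomial.eval w P := eval_slice_zero _ _ _
  have hr0' : r.derivative.eval 0 = MvPolynomial.eval w (MvPolynomial.pderiv i P) := by
    rw [hr, derivative_slice_single, eval_slice_zero]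
  rw [← hr0, ← hr0',
    (IsAlgClosed.splits r).eval_derivative_div_eval_of_ne_zero (x := 0) (by rwa [hr0])]
  have hroots : ∀ τ ∈ r.roots, (1 / (0 - τ)).im ≤ 0 := by
    intro τ hτ
    have hτim : τ.im ≤ 0 := by
      by_contra hlt
      refine hP.upper.eval_ne_zero_of_boundary (by simp) (z := w) (v := Pi.single i 1)
        (t₀ := τ) (t₁ := 0) (by simpa using hwim) (fun j => ?_) (by linarith) (by simpa using hg) ?_
      · by_cases hj : j = i <;> simp [hj]
      · rw [← eval_slice]
        exact isRoot_of_mem_roots hτ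
    rw [one_div, Complex.inv_im, zero_sub, Complex.neg_im, neg_neg]
    exact div_nonpos_of_nonpos_of_nonneg hτim (Complex.normSq_nonneg _)
  generalize r.roots = M at hroots
  induction M using Multiset.induction_on with
  | empty => simp
  | cons τ M ih =>
    rw [Multiset.map_cons, Multiset.sum_cons, Complex.add_im]
    have h1 := hroots τ (Multiset.mem_cons_self _ _)
    have h2 := ih fun τ hτ => hroots τ (Multiset.mem_cons_of_mem hτ)
    linarith

/-- The barrier function decreases in every coordinate above the zeros. -/
theorem IsBistable.barrier_anti (hP : IsBistable P) (ha : AboveRoots P a) (i : ι) {b : ι → ℝ}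
    (hab : ∀ j, a j ≤ b j) : barrier P i b ≤ barrier P i a := by
  have hu : ∀ j, 0 ≤ (b - a) j := fun j => sub_nonneg.2 (hab j)
  have := re_div_eval_one_le (fun z hz => hP.slice_root_im ha hu hz)
    (fun s hs => hP.slice_div_im_nonpos ha hu i hs) (fun s hs => ha.slice_eval_ne_zero hu hs)
  simpa [eval_slice, barrier] using this

end Slices

/-! ### The barrier argument -/

section Barrier

variable {P : MvPolynomial ι ℂ} {a : ι → ℝ} {n : ℕ} {u₀ δ : ℝ}

theorem IsBistable.sub_pderiv (hP : IsBistable P) (i : ι) :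
    IsBistable (P - MvPolynomial.pderiv i P) :=
  ⟨hP.upper.sub_pderiv i, hP.lower.sub_pderiv i⟩

/-- Applying `1 - ∂/∂z_i` and moving up by `δ` in the `i`-th coordinate keeps the point above the
zeros and does not increase the other barrier functions. -/
theorem IsBistable.barrier_step (hP : IsBistable P) (ha : AboveRoots P a)
    (hdeg : ∀ i, MvPolynomial.degreeOf i P ≤ n + 1) (hu : 0 ≤ u₀) (hδ : 0 < δ)
    (hcond : n * u₀ / (1 + δ * u₀) ≤ 1 - 1 / δ) (i : ι) (hbar : barrier P i a ≤ n * u₀) :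
    AboveRoots (P - MvPolynomial.pderiv i P) (fun j => a j + δ * (Pi.single i 1 : ι → ℝ) j) ∧
      ∀ j, barrier (P - MvPolynomial.pderiv i P) j
        (fun j => a j + δ * (Pi.single i 1 : ι → ℝ) j) ≤ barrier P j a := by
  set b : ι → ℝ := fun j => a j + δ * (Pi.single i 1 : ι → ℝ) j with hb
  have he : ∀ j, 0 ≤ (Pi.single i 1 : ι → ℝ) j := fun j => by
    by_cases hj : j = i <;> simp [hj]
  have hab : ∀ j, a j ≤ b j := fun j => by
    have := mul_nonneg hδ.le (he j)
    simp only [hb]; linarith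
  have hroot := fun z hz => hP.slice_root_im (z := z) ha he hz
  have hpos := fun s hs => ha.slice_eval_ne_zero (s := s) he hs
  have hgd := (natDegree_slice_single_le P (fun j => (a j : ℂ)) i).trans (hdeg i)
  have hbe : ∀ Q : MvPolynomial ι ℂ, (slice Q (fun j => (a j : ℂ)) (Pi.single i 1)).eval (δ : ℂ)
      = MvPolynomial.eval (fun j => (b j : ℂ)) Q := by
    intro Q
    rw [eval_slice]
    congr 2
    funext j
    simp only [hb]
    push_cast
    ring
  have hbar' : ((slice P (fun j => (a j : ℂ)) (Pi.single i 1)).derivative.eval 0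
      / (slice P (fun j => (a j : ℂ)) (Pi.single i 1)).eval 0).re ≤ n * u₀ := by
    rw [derivative_slice_single, eval_slice_zero, eval_slice_zero]
    exact hbar
  have hlt : barrier P i b < 1 := by
    have := derivative_div_re_lt_one hroot hpos hgd hu hδ hcond hbar'
    rwa [derivative_slice_single, hbe, hbe] at this
  have hPb : AboveRoots P b := fun u hbu => ha u fun j => (hab j).trans (hbu j)
  refine ⟨fun u hbu h0 => ?_, fun j => ?_⟩
  · have h1 := (hP.barrier_anti hPb i hbu).trans_lt hlt
    rw [map_sub, sub_eq_zero] at h0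
    rw [barrier, ← h0, div_self (hPb u hbu)] at h1
    simp at h1
  · have hhd := (natDegree_slice_single_le (MvPolynomial.pderiv j P) (fun j => (a j : ℂ)) i).trans
      ((degreeOf_pderiv_le P j i).trans (hdeg i))
    have := shift_re_div_le hroot (fun s hs => hP.slice_div_im_nonpos ha he j hs) hpos hgd hhd hu hδ
      hcond hbar'
    rw [derivative_slice_single, derivative_slice_single, pderiv_pderiv_comm, ← slice_sub,
      ← slice_sub, ← map_sub, hbe, hbe, eval_slice_zero, eval_slice_zero] at this
    exact this

/-- Applying `1 - ∂/∂z_i` successively for the indices in `l` raises those coordinates of a point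
above the zeros by `δ`. -/
theorem IsBistable.barrier_prod (hP : IsBistable P) (ha : AboveRoots P a)
    (hdeg : ∀ i, MvPolynomial.degreeOf i P ≤ n + 1) (hu : 0 ≤ u₀) (hδ : 0 < δ)
    (hcond : n * u₀ / (1 + δ * u₀) ≤ 1 - 1 / δ) (hbar : ∀ i, barrier P i a ≤ n * u₀)
    {l : List ι} (hl : l.Nodup) :
    AboveRoots ((l.map fun i => (1 - (MvPolynomial.pderiv i).toLinearMap :
        Module.End ℂ (MvPolynomial ι ℂ))).prod P) (fun j => a j + if j ∈ l then δ else 0) := by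
  suffices h : ∃ Q, Q = ((l.map fun i => (1 - (MvPolynomial.pderiv i).toLinearMap :
        Module.End ℂ (MvPolynomial ι ℂ))).prod P) ∧ IsBistable Q ∧
      (∀ i, MvPolynomial.degreeOf i Q ≤ n + 1) ∧
      AboveRoots Q (fun j => a j + if j ∈ l then δ else 0) ∧
      ∀ i, barrier Q i (fun j => a j + if j ∈ l then δ else 0) ≤ n * u₀ by
    obtain ⟨Q, rfl, -, -, h, -⟩ := h
    exact h
  induction l with
  | nil => exact ⟨P, by simp, hP, hdeg, by simpa using ha, by simpa using hbar⟩
  | cons i l ih =>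
    obtain ⟨Q, hQ, h1, h2, h3, h4⟩ := ih hl.of_cons
    have hi : i ∉ l := (List.nodup_cons.1 hl).1
    obtain ⟨h5, h6⟩ := h1.barrier_step h3 h2 hu hδ hcond i (h4 i)
    have hpt : (fun j => (a j + if j ∈ l then δ else 0) + δ * (Pi.single i 1 : ι → ℝ) j)
        = fun j => a j + if j ∈ i :: l then δ else 0 := by
      funext j
      by_cases hj : j = i
      · subst hj; simp [hi]
      · simp [hj]
    rw [hpt] at h5 h6
    refine ⟨Q - MvPolynomial.pderiv i Q, by simp [hQ], h1.sub_pderiv i, fun j => ?_, h5,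
      fun j => (h6 j).trans (h4 j)⟩
    exact (MvPolynomial.degreeOf_sub_le _ _ _).trans
      (max_le (h2 j) ((degreeOf_pderiv_le _ _ _).trans (h2 j)))

end Barrier

end Multivariate

/-! ### Determinantal polynomials -/

section Determinant

open scoped Matrix

variable {m d : ℕ}

/-- The determinant `det (x I + ∑ i, z_i A_i)` for a fixed complex number `x`, as a polynomial in
the `z_i`. -/
noncomputable def detAt (A : Fin m → Matrix (Fin d) (Fin d) ℂ) (x : ℂ) : MvPolynomial (Fin m) ℂ :=
  MvPolynomial.map (evalRingHom x) (mixedDet A)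

theorem detAt_eq_det (A : Fin m → Matrix (Fin d) (Fin d) ℂ) (x : ℂ) :
    detAt A x = Matrix.det ((MvPolynomial.C x : MvPolynomial (Fin m) ℂ) • 1
      + ∑ i, (MvPolynomial.X i : MvPolynomial (Fin m) ℂ) • (A i).map MvPolynomial.C) := by
  rw [detAt, mixedDet, RingHom.map_det]
  congr 1
  ext r s : 1
  simp [Matrix.sum_apply, Matrix.one_apply, apply_ite]

theorem eval_detAt (A : Fin m → Matrix (Fin d) (Fin d) ℂ) (x : ℂ) (z : Fin m → ℂ) :
    MvPolynomial.eval z (detAt A x) = Matrix.det (x • (1 : Matrix (Fin d) (Fin d) ℂ)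
      + ∑ i, z i • A i) := by
  rw [detAt_eq_det, RingHom.map_det]
  congr 1
  ext r s : 1
  simp [Matrix.sum_apply, Matrix.one_apply, apply_ite]

theorem eval_mixedCharpoly (A : Fin m → Matrix (Fin d) (Fin d) ℂ) (x : ℂ) :
    (mixedCharpoly A).eval x = MvPolynomial.eval (fun _ => 0)
      (((List.finRange m).map fun i => (1 - (MvPolynomial.pderiv i).toLinearMap :
        Module.End ℂ (MvPolynomial (Fin m) ℂ))).prod (detAt A x)) := by
  have key : ∀ (l : List (Fin m)) (P : MvPolynomial (Fin m) ℂ[X]),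
      MvPolynomial.map (evalRingHom x) ((l.map fun i => (1 - (MvPolynomial.pderiv i).toLinearMap :
        Module.End ℂ[X] (MvPolynomial (Fin m) ℂ[X]))).prod P)
      = (l.map fun i => (1 - (MvPolynomial.pderiv i).toLinearMap :
        Module.End ℂ (MvPolynomial (Fin m) ℂ))).prod (MvPolynomial.map (evalRingHom x) P) := by
    intro l P
    induction l with
    | nil => simp
    | cons i l ih => simp [← ih, MvPolynomial.pderiv_map]
  rw [mixedCharpoly, oneSubPDerivProd, List.ofFn_eq_map, detAt, ← key, ← coe_evalRingHom,
    MvPolynomial.map_eval]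
  congr 2
  funext i
  simp

/-- A zero of `det (x I + ∑ i, z_i A_i)` yields a vanishing combination of the quadratic forms of
`I` and of the `A i` at a kernel vector. -/
theorem exists_of_det_eq_zero {A : Fin m → Matrix (Fin d) (Fin d) ℂ}
    (hpsd : ∀ i, (A i).PosSemidef) (hsum : (1 - ∑ i, A i).PosSemidef) {x : ℂ} {z : Fin m → ℂ}
    (h : Matrix.det (x • (1 : Matrix (Fin d) (Fin d) ℂ) + ∑ i, z i • A i) = 0) :
    ∃ (N : ℝ) (p : Fin m → ℝ), 0 < N ∧ (∀ i, 0 ≤ p i) ∧ ∑ i, p i ≤ N ∧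
      x * N + ∑ i, z i * p i = 0 := by
  obtain ⟨v, hv, hMv⟩ := Matrix.exists_mulVec_eq_zero_iff.2 h
  have hN : 0 < star v ⬝ᵥ v := Matrix.dotProduct_star_self_pos_iff.2 hv
  have hp : ∀ i, 0 ≤ star v ⬝ᵥ (A i).mulVec v := fun i => (hpsd i).dotProduct_mulVec_nonneg v
  have hs := hsum.dotProduct_mulVec_nonneg v
  have e := congrArg (fun w => star v ⬝ᵥ w) hMv
  simp only [Matrix.add_mulVec, Matrix.smul_mulVec, Matrix.one_mulVec, Matrix.sum_mulVec,
    dotProduct_add, dotProduct_smul, dotProduct_sum, dotProduct_zero, smul_eq_mul] at e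
  rw [Matrix.sub_mulVec, Matrix.one_mulVec, Matrix.sum_mulVec, dotProduct_sub, dotProduct_sum] at hs
  have cN : star v ⬝ᵥ v = ((star v ⬝ᵥ v).re : ℂ) := Complex.eq_re_of_ofReal_le hN.le
  have cp : ∀ i, star v ⬝ᵥ (A i).mulVec v = ((star v ⬝ᵥ (A i).mulVec v).re : ℂ) :=
    fun i => Complex.eq_re_of_ofReal_le (hp i)
  refine ⟨(star v ⬝ᵥ v).re, fun i => (star v ⬝ᵥ (A i).mulVec v).re, (Complex.lt_def.1 hN).1,
    fun i => (Complex.le_def.1 (hp i)).1, ?_, ?_⟩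
  · have := (Complex.le_def.1 hs).1
    simp only [Complex.zero_re, Complex.sub_re, Complex.re_sum] at this
    linarith
  · rw [← cN, Finset.sum_congr rfl fun i _ => by rw [← cp i]]
    exact e

section PosSemidef

variable {A : Fin m → Matrix (Fin d) (Fin d) ℂ} (hpsd : ∀ i, (A i).PosSemidef)
  (hsum : (1 - ∑ i, A i).PosSemidef)
include hpsd hsum

theorem nonvanishingOn_detAt_of_im {σ : ℝ} {x : ℂ} (hx : 0 < σ * x.im) :
    NonvanishingOn σ (-(σ * x.im) / 2) (detAt A x) := by
  intro z hz h
  rw [eval_detAt] at h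
  obtain ⟨N, p, hN, hp, hpN, e⟩ := exists_of_det_eq_zero hpsd hsum h
  have e := congrArg (fun w : ℂ => σ * w.im) e
  simp only [Complex.add_im, Complex.im_mul_ofReal, Complex.im_sum, Complex.zero_im, mul_zero,
    mul_add, Finset.mul_sum] at e
  have h1 : ∑ i, -(σ * x.im) / 2 * p i ≤ ∑ i, σ * ((z i).im * p i) := by
    refine Finset.sum_le_sum fun i _ => ?_
    rw [← mul_assoc]
    exact mul_le_mul_of_nonneg_right (hz i).le (hp i)
  rw [← Finset.mul_sum] at h1
  nlinarith [mul_pos hx hN]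

theorem nonvanishingOn_detAt_of_pos {σ : ℝ} {x : ℝ} (hx : 0 < x) :
    NonvanishingOn σ 0 (detAt A x) := by
  intro z hz h
  rw [eval_detAt] at h
  obtain ⟨N, p, hN, hp, hpN, e⟩ := exists_of_det_eq_zero hpsd hsum h
  have e' := congrArg (fun w : ℂ => σ * w.im) e
  simp only [Complex.add_im, Complex.im_mul_ofReal, Complex.im_sum, Complex.zero_im, mul_zero,
    Finset.mul_sum, Complex.ofReal_im, zero_mul, zero_add] at e'
  have hp0 : ∀ i, p i = 0 := by
    intro i
    have := (Finset.sum_eq_zero_iff_of_nonneg (fun i _ => by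
      rw [← mul_assoc]; exact mul_nonneg (hz i).le (hp i))).1 e' i (Finset.mem_univ i)
    rw [← mul_assoc] at this
    exact (mul_eq_zero.1 this).resolve_left (hz i).ne'
  simp only [hp0, Complex.ofReal_zero, mul_zero, Finset.sum_const_zero, add_zero] at e
  have : x * N = 0 := by exact_mod_cast e
  have := mul_pos hx hN
  linarith

theorem aboveRoots_detAt {x δ : ℝ} (hδ : 0 < δ) (hx : δ < x) :
    AboveRoots (detAt A x) (fun _ => -δ) := by
  intro z hz h
  rw [eval_detAt] at h
  obtain ⟨N, p, hN, hp, hpN, e⟩ := exists_of_det_eq_zero hpsd hsum h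
  have e : x * N + ∑ i, z i * p i = 0 := by exact_mod_cast e
  have h1 : ∑ i, -δ * p i ≤ ∑ i, z i * p i :=
    Finset.sum_le_sum fun i _ => mul_le_mul_of_nonneg_right (hz i) (hp i)
  rw [← Finset.mul_sum] at h1
  nlinarith

end PosSemidef

open scoped MatrixOrder in
theorem trace_mul_nonneg_of_posSemidef {B X : Matrix (Fin d) (Fin d) ℂ} (hB : B.PosSemidef)
    (hX : X.PosSemidef) : 0 ≤ (B * X).trace := by
  obtain ⟨Y, rfl⟩ := CStarAlgebra.nonneg_iff_eq_star_mul_self.mp hX.nonneg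
  rw [← mul_assoc, Matrix.trace_mul_comm, ← mul_assoc]
  exact (hB.mul_mul_conjTranspose_same Y).trace_nonneg

/-- If `M ≥ t` then `t tr (M⁻¹ X) ≤ tr X`, because
`1 - t M⁻¹ = (1 - t M⁻¹)² + t M⁻¹ (M - t) M⁻¹ ≥ 0`. -/
theorem mul_trace_inv_mul_le {M X : Matrix (Fin d) (Fin d) ℂ} {t : ℝ} (ht : 0 < t)
    (hM : (M - (t : ℂ) • 1).PosSemidef) (hdet : IsUnit M.det) (hX : X.PosSemidef) :
    t * (M⁻¹ * X).trace.re ≤ X.trace.re := by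
  have hMh : M.IsHermitian := by
    have h1 : ((t : ℂ) • (1 : Matrix (Fin d) (Fin d) ℂ)).IsHermitian := by
      simp [Matrix.IsHermitian, Matrix.conjTranspose_smul]
    simpa using hM.1.add h1
  have hNh : (M⁻¹)ᴴ = M⁻¹ := hMh.inv
  set N := M⁻¹ with hN
  have hNM : N * M = 1 := Matrix.nonsing_inv_mul M hdet
  have h1 : (1 - (t : ℂ) • N).PosSemidef := by
    have e : 1 - (t : ℂ) • N = (1 - (t : ℂ) • N)ᴴ * (1 - (t : ℂ) • N)
        + (t : ℂ) • (Nᴴ * (M - (t : ℂ) • 1) * N) := by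
      have : (1 - (t : ℂ) • N)ᴴ = 1 - (t : ℂ) • N := by
        simp [Matrix.conjTranspose_sub, Matrix.conjTranspose_smul, hNh]
      rw [this, hNh]
      simp only [mul_sub, sub_mul, hNM, one_mul, mul_one, Matrix.smul_mul, Matrix.mul_smul,
        smul_sub]
      abel
    rw [e]
    refine (Matrix.posSemidef_conjTranspose_mul_self _).add ?_
    exact (hM.conjTranspose_mul_mul_same N).smul (by exact_mod_cast ht.le)
  have h2 := (Complex.le_def.1 (trace_mul_nonneg_of_posSemidef h1 hX)).1
  rw [sub_mul, one_mul, Matrix.smul_mul, Matrix.trace_sub, Matrix.trace_smul, smul_eq_mul,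
    Complex.sub_re, Complex.re_ofReal_mul, Complex.zero_re] at h2
  linarith

/-- The initial barrier values: at `-δ` in all coordinates the matrix `x - δ ∑ A_i` is at least
`x - δ`. -/
theorem barrier_detAt_le {A : Fin m → Matrix (Fin d) (Fin d) ℂ} (hpsd : ∀ i, (A i).PosSemidef)
    (hsum : (1 - ∑ i, A i).PosSemidef) {x δ : ℝ} (hδ : 0 < δ) (hx : δ < x) (i : Fin m) :
    barrier (detAt A x) i (fun _ => -δ) ≤ (A i).trace.re / (x - δ) := by
  set M : Matrix (Fin d) (Fin d) ℂ := (x : ℂ) • 1 + ∑ j, ((-δ : ℝ) : ℂ) • A j with hM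
  have hdet0 : M.det ≠ 0 := by
    have := aboveRoots_detAt hpsd hsum hδ hx (fun _ => -δ) fun _ => le_rfl
    rwa [eval_detAt] at this
  have hdet : IsUnit M.det := hdet0.isUnit
  have hMt : (M - ((x - δ : ℝ) : ℂ) • 1).PosSemidef := by
    have : M - ((x - δ : ℝ) : ℂ) • 1 = (δ : ℂ) • (1 - ∑ j, A j) := by
      rw [hM, ← Finset.smul_sum]
      push_cast
      module
    rw [this]
    exact hsum.smul (by exact_mod_cast hδ.le)
  -- on the line through the base point the determinant is `det M * det (1 + t M⁻¹ A_i)`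
  have hslice : slice (detAt A x) (fun _ => ((-δ : ℝ) : ℂ)) (Pi.single i 1)
      = C M.det * Matrix.det (1 + (X : ℂ[X]) • (M⁻¹ * A i).map C) := by
    refine Polynomial.funext fun s => ?_
    rw [eval_slice, eval_detAt, eval_mul, eval_C, ← coe_evalRingHom, RingHom.map_det]
    have h1 : (evalRingHom s).mapMatrix (1 + (X : ℂ[X]) • (M⁻¹ * A i).map C)
        = 1 + s • (M⁻¹ * A i) := by
      generalize M⁻¹ * A i = K
      ext r c
      simp [Matrix.one_apply, apply_ite]
      exact mul_comm _ _
    have h2 : ∑ j, (((-δ : ℝ) : ℂ) + ((Pi.single i (1 : ℝ) : Fin m → ℝ) j : ℂ) * s) • A j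
        = ∑ j, ((-δ : ℝ) : ℂ) • A j + s • A i := by
      simp only [add_smul, Finset.sum_add_distrib]
      congr 1
      rw [Finset.sum_eq_single i] <;> simp +contextual
    rw [h1, h2, ← add_assoc, ← hM, ← Matrix.det_mul, mul_add, mul_one, Matrix.mul_smul,
      ← mul_assoc, Matrix.mul_nonsing_inv M hdet, one_mul]
  have e1 : MvPolynomial.eval (fun _ => ((-δ : ℝ) : ℂ)) (detAt A x) = M.det := by
    rw [eval_detAt]
  have e2 : MvPolynomial.eval (fun _ => ((-δ : ℝ) : ℂ)) (MvPolynomial.pderiv i (detAt A x))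
      = M.det * (M⁻¹ * A i).trace := by
    rw [← eval_slice_zero _ _ (Pi.single i 1), ← derivative_slice_single, hslice,
      derivative_C_mul, eval_mul, eval_C, Matrix.derivative_det_one_add_X_smul]
  rw [barrier, e1, e2, mul_div_cancel_left₀ _ hdet0, le_div_iff₀ (by linarith), mul_comm]
  exact mul_trace_inv_mul_le (by linarith) hMt hdet (hpsd i)

/-- Diagonalising `A i` leaves `z_i` in only as many rows as `A i` has nonzero eigenvalues. -/
theorem degreeOf_detAt_le_rank (A : Fin m → Matrix (Fin d) (Fin d) ℂ) (x : ℂ) (i : Fin m)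
    (hA : (A i).IsHermitian) : MvPolynomial.degreeOf i (detAt A x) ≤ (A i).rank := by
  set U : Matrix (Fin d) (Fin d) ℂ := hA.eigenvectorUnitary.1 with hU
  have hUU : star U * U = 1 := Unitary.coe_star_mul_self hA.eigenvectorUnitary
  have hdiag : star U * A i * U = Matrix.diagonal (fun r => (hA.eigenvalues r : ℂ)) := by
    conv_lhs => rw [hA.spectral_theorem, Unitary.conjStarAlgAut_apply, ← hU]
    rw [show star U * (U * Matrix.diagonal (RCLike.ofReal ∘ hA.eigenvalues) * star U) * U
      = (star U * U) * Matrix.diagonal (RCLike.ofReal ∘ hA.eigenvalues) * (star U * U) by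
        simp only [mul_assoc], hUU, one_mul, mul_one]
    rfl
  let f : Matrix (Fin d) (Fin d) ℂ →+* Matrix (Fin d) (Fin d) (MvPolynomial (Fin m) ℂ) :=
    (MvPolynomial.C : ℂ →+* MvPolynomial (Fin m) ℂ).mapMatrix
  set B : Matrix (Fin d) (Fin d) (MvPolynomial (Fin m) ℂ) := f (star U) *
    ((MvPolynomial.C x : MvPolynomial (Fin m) ℂ) • 1
      + ∑ i, (MvPolynomial.X i : MvPolynomial (Fin m) ℂ) • (A i).map MvPolynomial.C) * f U with hB
  have hdet : detAt A x = B.det := by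
    rw [hB, Matrix.det_mul, Matrix.det_mul, ← detAt_eq_det, mul_right_comm, ← Matrix.det_mul,
      ← map_mul, hUU, map_one, Matrix.det_one, one_mul]
  have hBe : B = (MvPolynomial.C x : MvPolynomial (Fin m) ℂ) • 1
      + ∑ j, (MvPolynomial.X j : MvPolynomial (Fin m) ℂ) • f (star U * A j * U) := by
    have h1 : ∀ j, (A j).map MvPolynomial.C = f (A j) := fun j => rfl
    simp only [hB, h1, mul_add, add_mul, Matrix.mul_smul, Matrix.smul_mul, mul_one, Finset.mul_sum,
      Finset.sum_mul, ← map_mul, hUU, map_one]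
  have hentry : ∀ r s, MvPolynomial.degreeOf i (B r s)
      ≤ if hA.eigenvalues r ≠ 0 then 1 else 0 := by
    intro r s
    rw [hBe]
    simp only [Matrix.add_apply, Matrix.smul_apply, Matrix.sum_apply, smul_eq_mul]
    refine (MvPolynomial.degreeOf_add_le _ _ _).trans (max_le ?_ ?_)
    · refine le_trans (le_of_eq ?_) (Nat.zero_le _)
      rw [Matrix.one_apply]
      split_ifs <;> simp
    · refine (MvPolynomial.degreeOf_sum_le _ _ _).trans (Finset.sup_le fun j _ => ?_)
      have hc : f (star U * A j * U) r s = MvPolynomial.C ((star U * A j * U) r s) := rfl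
      rw [hc]
      by_cases hj : j = i
      · subst hj
        by_cases hr : hA.eigenvalues r = 0
        · rw [hdiag]
          by_cases hrs : r = s
          · subst hrs
            rw [Matrix.diagonal_apply_eq, hr]
            simp
          · rw [Matrix.diagonal_apply_ne _ hrs]
            simp
        · simp only [ne_eq, hr, not_false_eq_true, if_true]
          refine (MvPolynomial.degreeOf_mul_le _ _ _).trans ?_
          simp
      · refine ((MvPolynomial.degreeOf_mul_le _ _ _).trans ?_).trans (Nat.zero_le _)
        simp [MvPolynomial.degreeOf_X, Ne.symm hj]
  rw [hdet, Matrix.det_apply, hA.rank_eq_card_non_zero_eigs, Fintype.card_subtype,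
    Finset.card_filter]
  refine (MvPolynomial.degreeOf_sum_le _ _ _).trans (Finset.sup_le fun τ _ => ?_)
  have h1 : MvPolynomial.degreeOf i (∏ r, B (τ r) r)
      ≤ ∑ r, if hA.eigenvalues r ≠ 0 then 1 else 0 := by
    refine (MvPolynomial.degreeOf_prod_le _ _ _).trans ?_
    rw [← Equiv.sum_comp τ fun r => if hA.eigenvalues r ≠ 0 then 1 else 0]
    exact Finset.sum_le_sum fun r _ => hentry _ _
  rcases Int.units_eq_one_or (Equiv.Perm.sign τ) with h | h
  · simpa [h] using h1
  · simpa [h, MvPolynomial.degreeOf_neg] using h1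

end Determinant

/-! ### The degree of the mixed characteristic polynomial -/

section Weight

variable {ι : Type*}

/-- Every monomial `x ^ j * z ^ α` of `P` has total degree `j + |α|` less than `n`. -/
def WeightLT (n : ℕ) (P : MvPolynomial ι ℂ[X]) : Prop :=
  ∀ (α : ι →₀ ℕ) (j : ℕ), n ≤ α.degree + j → (P.coeff α).coeff j = 0

theorem WeightLT.add {n : ℕ} {P Q : MvPolynomial ι ℂ[X]} (hP : WeightLT n P) (hQ : WeightLT n Q) :
    WeightLT n (P + Q) := fun α j h => by
  rw [MvPolynomial.coeff_add, coeff_add, hP α j h, hQ α j h, add_zero]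

theorem WeightLT.neg {n : ℕ} {P : MvPolynomial ι ℂ[X]} (hP : WeightLT n P) :
    WeightLT n (-P) := fun α j h => by
  rw [MvPolynomial.coeff_neg, coeff_neg, hP α j h, neg_zero]

theorem WeightLT.sum {n : ℕ} {κ : Type*} {s : Finset κ} {P : κ → MvPolynomial ι ℂ[X]}
    (hP : ∀ i ∈ s, WeightLT n (P i)) : WeightLT n (∑ i ∈ s, P i) := fun α j h => by
  rw [MvPolynomial.coeff_sum, finsetSum_coeff]
  exact Finset.sum_eq_zero fun i hi => hP i hi α j h

theorem WeightLT.mul {n n' : ℕ} {P Q : MvPolynomial ι ℂ[X]} (hP : WeightLT (n + 1) P)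
    (hQ : WeightLT (n' + 1) Q) : WeightLT (n + n' + 1) (P * Q) := fun α j h => by
  classical
  rw [MvPolynomial.coeff_mul, finsetSum_coeff]
  refine Finset.sum_eq_zero fun β hβ => ?_
  rw [coeff_mul]
  refine Finset.sum_eq_zero fun i hi => ?_
  rw [Finset.HasAntidiagonal.mem_antidiagonal] at hβ hi
  rw [← hβ, ← hi, map_add] at h
  by_cases h1 : n + 1 ≤ β.1.degree + i.1
  · rw [hP _ _ h1, zero_mul]
  · rw [hQ _ _ (by omega), mul_zero]

theorem WeightLT.one : WeightLT 1 (1 : MvPolynomial ι ℂ[X]) := fun α j h => by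
  classical
  rw [MvPolynomial.coeff_one]
  split_ifs with h0
  · subst h0
    rw [map_zero] at h
    rw [coeff_one, if_neg (by omega)]
  · simp

theorem WeightLT.prod {κ : Type*} {s : Finset κ} {P : κ → MvPolynomial ι ℂ[X]}
    (hP : ∀ i ∈ s, WeightLT 2 (P i)) : WeightLT (s.card + 1) (∏ i ∈ s, P i) := by
  classical
  induction s using Finset.induction_on with
  | empty => simpa using WeightLT.one
  | insert i s hi ih =>
    rw [Finset.prod_insert hi, Finset.card_insert_of_notMem hi, add_comm s.card 1]
    exact (hP i (Finset.mem_insert_self _ _)).mul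
      (ih fun j hj => hP j (Finset.mem_insert_of_mem hj))

theorem WeightLT.pderiv {n : ℕ} {P : MvPolynomial ι ℂ[X]} (hP : WeightLT (n + 1) P) (i : ι) :
    WeightLT n (MvPolynomial.pderiv i P) := fun α j h => by
  rw [MvPolynomial.coeff_pderiv]
  have h1 := hP (α + Finsupp.single i 1) j (by simp; omega)
  rw [show ((α i : ℂ[X]) + 1) = C ((α i : ℂ) + 1) by simp, coeff_mul_C, h1, zero_mul]

theorem WeightLT.mono {n n' : ℕ} {P : MvPolynomial ι ℂ[X]} (hP : WeightLT n P) (h : n ≤ n') :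
    WeightLT n' P := fun α j hj => hP α j (h.trans hj)

end Weight

section Degree

variable {m d : ℕ} (A : Fin m → Matrix (Fin d) (Fin d) ℂ)

theorem weightLT_mixedDet : WeightLT (d + 1) (mixedDet A) := by
  classical
  have hX : WeightLT 2 (MvPolynomial.C (X : ℂ[X]) : MvPolynomial (Fin m) ℂ[X]) := fun α j h => by
    rw [MvPolynomial.coeff_C]
    split_ifs with h0
    · subst h0
      rw [map_zero] at h
      exact coeff_X_of_ne_one (by omega)
    · simp
  have hXi : ∀ i, WeightLT 2 (MvPolynomial.X i : MvPolynomial (Fin m) ℂ[X]) := fun i α j h => by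
    rw [MvPolynomial.coeff_X]
    split_ifs with h0
    · subst h0
      rw [Finsupp.degree_single] at h
      rw [coeff_one, if_neg (by omega)]
    · simp
  have hC : ∀ c : ℂ, WeightLT 1 (MvPolynomial.C (C c) : MvPolynomial (Fin m) ℂ[X]) :=
    fun c α j h => by
      rw [MvPolynomial.coeff_C]
      split_ifs with h0
      · subst h0
        rw [map_zero] at h
        rw [coeff_C, if_neg (by omega)]
      · simp
  rw [mixedDet, Matrix.det_apply]
  refine WeightLT.sum fun τ _ => ?_
  have h1 : WeightLT (d + 1) (∏ r, (((MvPolynomial.C (X : ℂ[X]) : MvPolynomial (Fin m) ℂ[X]) •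
        (1 : Matrix (Fin d) (Fin d) (MvPolynomial (Fin m) ℂ[X]))
      + ∑ i, (MvPolynomial.X i : MvPolynomial (Fin m) ℂ[X]) •
          (A i).map (fun a : ℂ => (MvPolynomial.C (C a) : MvPolynomial (Fin m) ℂ[X])))
        (τ r) r)) := by
    have := WeightLT.prod (s := Finset.univ) fun r _ => (show WeightLT 2
      (((MvPolynomial.C (X : ℂ[X]) : MvPolynomial (Fin m) ℂ[X]) •
        (1 : Matrix (Fin d) (Fin d) (MvPolynomial (Fin m) ℂ[X]))
      + ∑ i, (MvPolynomial.X i : MvPolynomial (Fin m) ℂ[X]) •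
          (A i).map (fun a : ℂ => (MvPolynomial.C (C a) : MvPolynomial (Fin m) ℂ[X])))
        (τ r) r) from by
      simp only [Matrix.add_apply, Matrix.smul_apply, Matrix.sum_apply, smul_eq_mul,
        Matrix.map_apply]
      refine WeightLT.add ?_ (WeightLT.sum fun i _ => (hXi i).mul (n := 1) (n' := 0) (hC _))
      rw [Matrix.one_apply]
      split_ifs
      · simpa using hX
      · rw [mul_zero]
        exact fun α j _ => by simp)
    simpa using this
  rcases Int.units_eq_one_or (Equiv.Perm.sign τ) with h | h
  · simpa only [h, one_smul] using h1
  · simpa only [h, Units.neg_smul, one_smul] using h1.neg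

/-- Each derivative lowers the total degree, so only `det (x I)` contributes in degree `d`. -/
theorem coeff_mixedCharpoly {j : ℕ} (hj : d ≤ j) :
    (mixedCharpoly A).coeff j = (X ^ d : ℂ[X]).coeff j := by
  have key : ∀ l : List (Fin m), ∃ Q, Q = (l.map fun i => (1 - (MvPolynomial.pderiv i).toLinearMap :
        Module.End ℂ[X] (MvPolynomial (Fin m) ℂ[X]))).prod (mixedDet A) ∧
      WeightLT (d + 1) Q ∧ WeightLT d (Q - mixedDet A) := by
    intro l
    induction l with
    | nil =>
      exact ⟨mixedDet A, by simp, weightLT_mixedDet A, by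
        rw [sub_self]; exact fun α j _ => by simp⟩
    | cons i l ih =>
      obtain ⟨Q, hQ, h1, h2⟩ := ih
      have h3 := h1.pderiv i
      refine ⟨Q - MvPolynomial.pderiv i Q, by simp [hQ], ?_, ?_⟩
      · rw [sub_eq_add_neg]
        exact h1.add (h3.mono (Nat.le_succ d)).neg
      · rw [sub_right_comm, sub_eq_add_neg]
        exact h2.add h3.neg
  obtain ⟨Q, hQ, -, h⟩ := key (List.finRange m)
  have hconst : MvPolynomial.constantCoeff (mixedDet A) = X ^ d := by
    rw [mixedDet, RingHom.map_det]
    have : (MvPolynomial.constantCoeff (σ := Fin m)).mapMatrix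
        ((MvPolynomial.C (X : ℂ[X]) : MvPolynomial (Fin m) ℂ[X]) •
        (1 : Matrix (Fin d) (Fin d) (MvPolynomial (Fin m) ℂ[X]))
      + ∑ i, (MvPolynomial.X i : MvPolynomial (Fin m) ℂ[X]) •
          (A i).map (fun a : ℂ => (MvPolynomial.C (C a) : MvPolynomial (Fin m) ℂ[X])))
        = (X : ℂ[X]) • 1 := by
      ext r s : 1
      by_cases hrs : r = s <;> simp [Matrix.sum_apply, hrs]
    rw [this, Matrix.det_smul, Matrix.det_one, mul_one, Fintype.card_fin]
  have e : mixedCharpoly A = MvPolynomial.constantCoeff Q := by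
    rw [mixedCharpoly, oneSubPDerivProd, List.ofFn_eq_map, ← hQ, ← MvPolynomial.eval_zero]
    rfl
  have h0 := h 0 j (by simpa using hj)
  rw [MvPolynomial.coeff_sub, coeff_sub, sub_eq_zero] at h0
  rw [e, ← hconst]
  exact h0

theorem natDegree_mixedCharpoly_le : (mixedCharpoly A).natDegree ≤ d :=
  natDegree_le_iff_coeff_eq_zero.2 fun j hj => by
    rw [coeff_mixedCharpoly A hj.le, coeff_X_pow, if_neg (by omega)]

theorem monic_mixedCharpoly : (mixedCharpoly A).Monic :=
  monic_of_natDegree_le_of_coeff_eq_one d (natDegree_mixedCharpoly_le A)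
    (by rw [coeff_mixedCharpoly A le_rfl, coeff_X_pow_self])

theorem natDegree_mixedCharpoly : (mixedCharpoly A).natDegree = d :=
  le_antisymm (natDegree_mixedCharpoly_le A)
    (le_natDegree_of_ne_zero (by rw [coeff_mixedCharpoly A le_rfl, coeff_X_pow_self]; simp))

end Degree

/-! ### Roots of the mixed characteristic polynomial -/

section Roots

variable {m d : ℕ} {A : Fin m → Matrix (Fin d) (Fin d) ℂ}

theorem mixedCharpoly_root_im (hpsd : ∀ i, (A i).PosSemidef) (hsum : (1 - ∑ i, A i).PosSemidef)
    {x : ℂ} (hx : (mixedCharpoly A).IsRoot x) : x.im = 0 := by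
  have key : ∀ σ : ℝ, 0 < σ * x.im → False := by
    intro σ hσ
    have hprod : ∀ l : List (Fin m), ∃ Q, Q = (l.map fun i =>
        (1 - (MvPolynomial.pderiv i).toLinearMap :
          Module.End ℂ (MvPolynomial (Fin m) ℂ))).prod (detAt A x) ∧
        NonvanishingOn σ (-(σ * x.im) / 2) Q := by
      intro l
      induction l with
      | nil => exact ⟨_, by simp, nonvanishingOn_detAt_of_im hpsd hsum hσ⟩
      | cons i l ih =>
        obtain ⟨Q, hQ, h⟩ := ih
        exact ⟨Q - MvPolynomial.pderiv i Q, by simp [hQ], h.sub_pderiv i⟩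
    obtain ⟨Q, hQ, h⟩ := hprod (List.finRange m)
    rw [IsRoot, eval_mixedCharpoly, ← hQ] at hx
    exact h _ (fun i => by simp; linarith) hx
  rcases lt_trichotomy x.im 0 with h | h | h
  · exact (key (-1) (by linarith)).elim
  · exact h
  · exact (key 1 (by linarith)).elim

/-- The barrier bound: started at `-δ` in all coordinates, the barrier argument ends at the
origin. -/
theorem mixedCharpoly_eval_ne_zero {n : ℕ} {ε u₀ δ x : ℝ} (hpsd : ∀ i, (A i).PosSemidef)
    (hrank : ∀ i, (A i).rank ≤ n + 1) (hsum : (1 - ∑ i, A i).PosSemidef)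
    (hε : ∀ i, (A i).trace.re ≤ ε) (hδ : 0 < δ) (hx : δ < x) (hu : 0 ≤ u₀)
    (hcond : n * u₀ / (1 + δ * u₀) ≤ 1 - 1 / δ) (hbar : ε / (x - δ) ≤ n * u₀) :
    (mixedCharpoly A).eval (x : ℂ) ≠ 0 := by
  have hP : IsBistable (detAt A x) := ⟨nonvanishingOn_detAt_of_pos hpsd hsum (hδ.trans hx),
    nonvanishingOn_detAt_of_pos hpsd hsum (hδ.trans hx)⟩
  have h := hP.barrier_prod (aboveRoots_detAt hpsd hsum hδ hx)
    (fun i => (degreeOf_detAt_le_rank A x i (hpsd i).1).trans (hrank i)) hu hδ hcond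
    (fun i => (barrier_detAt_le hpsd hsum hδ hx i).trans (le_trans (by
      have : 0 < x - δ := by linarith
      gcongr
      exact hε i) hbar)) (List.nodup_finRange m)
  rw [eval_mixedCharpoly]
  simpa using h (fun _ => 0) (by simp)

/-- The choice of the shift: `δ = 1 + √ε / √(1 - ε / n)` minimises the bound obtained from the
barrier argument. -/
theorem exists_shift {n : ℕ} (hn : 1 ≤ n) {ε x : ℝ} (hε : 0 ≤ ε)
    (hεn : ε ≤ (n : ℝ) ^ 2 / (n + 1)) (hx : (√(1 - ε / n) + √ε) ^ 2 < x) :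
    ∃ δ u₀ : ℝ, 0 < δ ∧ δ < x ∧ 0 ≤ u₀ ∧ n * u₀ / (1 + δ * u₀) ≤ 1 - 1 / δ ∧
      ε / (x - δ) ≤ n * u₀ := by
  have hn0 : (0 : ℝ) < n := by exact_mod_cast hn
  rw [le_div_iff₀ (by linarith)] at hεn
  have hεlt : ε < n := by
    by_contra hlt
    nlinarith
  set e := √ε with he
  have he0 : 0 ≤ e := Real.sqrt_nonneg _
  have hee : e ^ 2 = ε := Real.sq_sqrt hε
  set r := √(1 - ε / n) with hr
  have hpos : 0 < 1 - ε / n := by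
    rw [sub_pos, div_lt_one hn0]; exact hεlt
  have hr0 : 0 < r := Real.sqrt_pos.2 hpos
  have hrr : r ^ 2 = 1 - ε / n := Real.sq_sqrt hpos.le
  have hεr : ε / n = 1 - r ^ 2 := by linarith
  have hle : 0 ≤ e * (r - e / n) := by
    refine mul_nonneg he0 (sub_nonneg.2 ?_)
    rw [← abs_of_nonneg (div_nonneg he0 hn0.le), ← abs_of_pos hr0, ← sq_le_sq, hrr, div_pow, hee,
      le_sub_iff_add_le, div_add_div _ _ (by positivity) hn0.ne', div_le_one (by positivity)]
    nlinarith
  have heq : e * (r - e / n) = e * r - (1 - r ^ 2) := by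
    rw [← hεr, ← hee]; ring
  set w := e / r with hw
  have hw0 : 0 ≤ w := div_nonneg he0 hr0.le
  have hwr : w * r = e := div_mul_cancel₀ _ hr0.ne'
  -- the distance left after the shift, at the claimed bound
  have hid : (r + e) ^ 2 - (1 + w) = (1 + w) * (e * (r - e / n)) := by
    rw [heq]
    linear_combination (-e - r) * hwr
  have ht : (1 + w) * (e * (r - e / n)) < x - (1 + w) := by rw [← hid]; linarith
  have ht0 : 0 < x - (1 + w) := lt_of_le_of_lt (mul_nonneg (by linarith) hle) ht
  set t := x - (1 + w) with htdef
  have hδ : 0 < 1 + w := by linarith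
  refine ⟨1 + w, ε / (t * n), hδ, by linarith, by positivity, ?_,
    le_of_eq (by rw [← htdef]; field_simp)⟩
  have h1 : n * (ε / (t * n)) / (1 + (1 + w) * (ε / (t * n))) = ε / (t + (1 + w) * (ε / n)) := by
    field_simp
  have h2 : 1 - 1 / (1 + w) = w / (1 + w) := by field_simp; ring
  rw [h1, h2, div_le_div_iff₀ (by positivity) hδ]
  have h3 : w * ((1 + w) * (e * (r - e / n)) + (1 + w) * (ε / n)) ≤ w * (t + (1 + w) * (ε / n)) := by
    gcongr
  refine le_trans (le_of_eq ?_) h3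
  rw [heq, hεr, ← hee]
  linear_combination (-(1 + w) * e) * hwr

end Roots

theorem mainTheorem4 (k m d : ℕ) (hk : 2 ≤ k) (hd : 1 ≤ d)
    (A : Fin m → Matrix (Fin d) (Fin d) ℂ)
    (hpsd : ∀ i, (A i).PosSemidef)
    (hrank : ∀ i, (A i).rank ≤ k)
    (hsum : (1 - ∑ i, A i).PosSemidef)
    (ε : ℝ) (hε : IsGreatest (Set.range fun i => (A i).trace.re) ε)
    (hεk : ε ≤ ((k : ℝ) - 1) ^ 2 / k) :
    ∃ p : ℝ[X], p.map (algebraMap ℝ ℂ) = mixedCharpoly A ∧ p.Splits ∧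
      ∃ r : ℝ, IsGreatest {x : ℝ | p.IsRoot x} r ∧
        r ≤ (Real.sqrt (1 - ε / ((k : ℝ) - 1)) + Real.sqrt ε) ^ 2 := by
  obtain ⟨n, rfl⟩ : ∃ n, k = n + 1 := ⟨k - 1, by omega⟩
  have hcast : (((n + 1 : ℕ) : ℝ) - 1) = n := by push_cast; ring
  rw [hcast] at hεk ⊢
  push_cast at hεk
  obtain ⟨⟨i₀, hi₀⟩, hmax⟩ := hε
  have hε0 : 0 ≤ ε := by
    rw [← hi₀]
    exact (Complex.le_def.1 (hpsd i₀).trace_nonneg).1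
  set p : ℝ[X] := ((mixedCharpoly A).roots.map fun z => X - C z.re).prod with hp
  have hmap : p.map (algebraMap ℝ ℂ) = mixedCharpoly A := by
    conv_rhs => rw [(IsAlgClosed.splits (mixedCharpoly A)).eq_prod_roots,
      (monic_mixedCharpoly A).leadingCoeff, C_1, one_mul]
    rw [hp, Polynomial.map_multiset_prod, Multiset.map_map]
    refine congrArg _ (Multiset.map_congr rfl fun z hz => ?_)
    have him := mixedCharpoly_root_im hpsd hsum (isRoot_of_mem_roots hz)
    have : ((z.re : ℝ) : ℂ) = z := by apply Complex.ext <;> simp [him]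
    simp [this]
  have hsplit : p.Splits := by
    refine Splits.multisetProd fun f hf => ?_
    obtain ⟨z, -, rfl⟩ := Multiset.mem_map.1 hf
    exact Splits.X_sub_C _
  have hdeg : p.natDegree = d := by
    rw [← natDegree_map (algebraMap ℝ ℂ), hmap, natDegree_mixedCharpoly]
  have hp0 : p ≠ 0 := by rintro h; rw [h] at hdeg; simp at hdeg; omega
  have hne : p.roots.toFinset.Nonempty := by
    rw [Multiset.toFinset_nonempty, ← Multiset.card_pos, splits_iff_card_roots.1 hsplit, hdeg]
    exact hd
  have hset : {x : ℝ | p.IsRoot x} = p.roots.toFinset := by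
    ext x; simp [hp0]
  refine ⟨p, hmap, hsplit, p.roots.toFinset.max' hne, ?_, ?_⟩
  · rw [hset]
    exact p.roots.toFinset.isGreatest_max' hne
  · by_contra hlt
    obtain ⟨δ, u₀, hδ, hδx, hu, hcond, hbar⟩ := exists_shift (by omega) hε0 hεk (not_le.1 hlt)
    refine mixedCharpoly_eval_ne_zero hpsd hrank hsum (fun i => hmax ⟨i, rfl⟩) hδ hδx hu hcond hbar ?_
    have hroot : p.IsRoot (p.roots.toFinset.max' hne) :=
      isRoot_of_mem_roots (Multiset.mem_toFinset.1 (Finset.max'_mem _ hne))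
    rw [← hmap, ← Complex.coe_algebraMap, eval_map_algebraMap, aeval_algebraMap_apply,
      coe_aeval_eq_eval, hroot.eq_zero, map_zero]
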